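/- For $k=2^I$, $I\in\{0,1,2,\dots\}$, let $K_k(x,y)=\sum_{j=1}^{k}\psi_{k,j}(x)\psi_{k,j}(y)$ with $\psi_{k,j}=\sqrt{k}\,\mathbf 1_{((j-1)/k,\,j/k]}$ be the Haar projection kernel, and for $k\le l$ put $D_{k,l}=K_l-K_k$. For $h:\mathbb R^3\to\mathbb R$ and observations $X_1,\dots,X_n$ let $$\mathbb V_n[h]=\frac{1}{n(n-1)(n-2)}\sum_{i_1,i_2,i_3\ \text{pairwise distinct}}h(X_{i_1},X_{i_2},X_{i_3}).$$ For $k_1\le k_2\le k_3$ consider the third-order U-statistic estimator of $\int f^3$ $$\begin{aligned}\widehat\phi_{k_1,k_2,k_3}={}&\mathbb V_n\Big[\int_0^1K_{k_1}(x,X_{i_1})K_{k_1}(x,X_{i_2})K_{k_1}(x,X_{i_3})\,dx\Big]\\&+3\,\mathbb V_n\Big[\int_0^1K_{k_1}(x,X_{i_1})D_{k_1,k_3}(x,X_{i_2})K_{k_1}(x,X_{i_3})\,dx\Big]\\&+3\,\mathbb V_n\Big[\int_0^1K_{k_1}(x,X_{i_1})D_{k_1,k_3}(x,X_{i_2})D_{k_1,k_3}(x,X_{i_3})\,dx\Big]\\&+3\,\mathbb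 V_n\Big[\int_0^1D_{k_1,k_2}(x,X_{i_1})D_{k_1,k_2}(x,X_{i_2})D_{k_2,k_3}(x,X_{i_3})\,dx\Big]\\&+\mathbb V_n\Big[\int_0^1D_{k_1,k_2}(x,X_{i_1})D_{k_1,k_2}(x,X_{i_2})D_{k_1,k_2}(x,X_{i_3})\,dx\Big].\end{aligned}$$ Theorem. Let $q\ge 1$ be real, $f_{\min}>0$, $f_{\max}\in\mathbb R$, $a>0$ and $A\in\mathbb R$. There exist a constant $C$ and an integer $n_0$, depending only on $q,f_{\min},f_{\max},a,A$, such that the following holds for every $\beta\in(0,1/4)$, every $n\ge n_0$, all powers of two $k_1\le k_2\le k_3$ with $$a\,n\le k_1\le A\,n,\qquad n^{\frac{3/2-2\beta}{1+4\beta}}\le k_2\le n^{\frac{3/2+2\beta}{1+4\beta}},\qquad a\,n^{\frac{2}{1+4\beta}}\le k_3\le A\,n^{\frac{2}{1+4\beta}},$$ and every probability density $f$ on $[0,1]$ with $f_{\min}\le f\le f_{\max}$ almost everywhere: if $X_1,\dots,X_n$ are i.i.d. with density $f$, then $\widehat\phi_{k_1,k_2,k_3}$ has a finite mean and a finite absolute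 moment of order $2q$ about its mean, and $$\mathbb E_f\Big|\widehat\phi_{k_1,k_2,k_3}-\mathbb E_f\widehat\phi_{k_1,k_2,k_3}\Big|^{2q}\le C\Big(\frac{k_3}{n^2}\Big)^q .$$ -/

import Mathlib

open MeasureTheory ProbabilityTheory

noncomputable section

/-- The Haar scaling function `ψ_{k,j} = √k · 1_{(j/k, (j+1)/k]}`, for `j = 0, …, k - 1`. -/
def haarScaling (k j : ℕ) (x : ℝ) : ℝ :=
  √(k : ℝ) * (Set.Ioc ((j : ℝ) / k) (((j : ℝ) + 1) / k)).indicator (fun _ => (1 : ℝ)) x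

/-- The Haar projection kernel `K_k(x, y) = ∑_j ψ_{k,j}(x) ψ_{k,j}(y)`.  For `k = 2 ^ I` it is the
kernel of the orthogonal projection of `L²[0,1]` onto the span of the first `k` Haar functions. -/
def haarKernel (k : ℕ) (x y : ℝ) : ℝ :=
  ∑ j ∈ Finset.range k, haarScaling k j x * haarScaling k j y

/-- The difference `K_l - K_k` of two Haar projection kernels. -/
def haarKernelDiff (k l : ℕ) (x y : ℝ) : ℝ :=
  haarKernel l x y - haarKernel k x y

/-- The third order U-statistic with (not necessarily symmetric) kernel `h`: the average of
`h (x i₁) (x i₂) (x i₃)` over all triples of pairwise distinct indices. -/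
def uStatThree (n : ℕ) (h : ℝ → ℝ → ℝ → ℝ) (x : Fin n → ℝ) : ℝ :=
  (∑ i₁ : Fin n, ∑ i₂ : Fin n, ∑ i₃ : Fin n,
      if i₁ ≠ i₂ ∧ i₁ ≠ i₃ ∧ i₂ ≠ i₃ then h (x i₁) (x i₂) (x i₃) else 0) /
    ((n : ℝ) * ((n : ℝ) - 1) * ((n : ℝ) - 2))

/-- The third order U-statistic estimator of `∫ f ^ 3` with truncation levels `k₁`, `k₂`, `k₃`,
as a function of the sample. -/
def cubicEstimator (k₁ k₂ k₃ n : ℕ) (x : Fin n → ℝ) : ℝ :=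
  uStatThree n (fun u v w =>
      ∫ t in (0 : ℝ)..1, haarKernel k₁ t u * haarKernel k₁ t v * haarKernel k₁ t w) x
  + 3 * uStatThree n (fun u v w =>
      ∫ t in (0 : ℝ)..1, haarKernel k₁ t u * haarKernelDiff k₁ k₃ t v * haarKernel k₁ t w) x
  + 3 * uStatThree n (fun u v w =>
      ∫ t in (0 : ℝ)..1,
        haarKernel k₁ t u * haarKernelDiff k₁ k₃ t v * haarKernelDiff k₁ k₃ t w) x
  + 3 * uStatThree n (fun u v w =>
      ∫ t in (0 : ℝ)..1,
        haarKernelDiff k₁ k₂ t u * haarKernelDiff k₁ k₂ t v * haarKernelDiff k₂ k₃ t w) x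
  + uStatThree n (fun u v w =>
      ∫ t in (0 : ℝ)..1,
        haarKernelDiff k₁ k₂ t u * haarKernelDiff k₁ k₂ t v * haarKernelDiff k₁ k₂ t w) x

/-- The law on `[0,1]` with Lebesgue density `f`. -/
def unitIntervalLaw (f : ℝ → ℝ) : Measure ℝ :=
  (volume.restrict (Set.Icc (0 : ℝ) 1)).withDensity (fun x => ENNReal.ofReal (f x))

/-- The truncation levels `k₁ ≤ k₂ ≤ k₃` at sample size `n` and smoothness `β`: powers of two with
`k₁ ∼ n`, `n^((3/2-2β)/(1+4β)) ≤ k₂ ≤ n^((3/2+2β)/(1+4β))` and `k₃ ∼ n^(2/(1+4β))`, where `∼` is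
equality up to factors in `[a, A]`. -/
structure AdmissibleLevels (a A β : ℝ) (n k₁ k₂ k₃ : ℕ) : Prop where
  dyadic₁ : ∃ I : ℕ, k₁ = 2 ^ I
  dyadic₂ : ∃ I : ℕ, k₂ = 2 ^ I
  dyadic₃ : ∃ I : ℕ, k₃ = 2 ^ I
  le₁₂ : k₁ ≤ k₂
  le₂₃ : k₂ ≤ k₃
  lower₁ : a * (n : ℝ) ≤ (k₁ : ℝ)
  upper₁ : (k₁ : ℝ) ≤ A * (n : ℝ)
  lower₂ : (n : ℝ) ^ ((3 / 2 - 2 * β) / (1 + 4 * β)) ≤ (k₂ : ℝ)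
  upper₂ : (k₂ : ℝ) ≤ (n : ℝ) ^ ((3 / 2 + 2 * β) / (1 + 4 * β))
  lower₃ : a * (n : ℝ) ^ (2 / (1 + 4 * β)) ≤ (k₃ : ℝ)
  upper₃ : (k₃ : ℝ) ≤ A * (n : ℝ) ^ (2 / (1 + 4 * β))

end

/-! The Haar intervals are nested, so when `a ∣ c` and `b ∣ c` the kernel `∫ K_a K_b K_c` equals `a
* b` times the indicator that the first point shares the `a`-bin, and the second the `b`-bin, of the
third (`haarTriple_eq`). The level `c` disappears. Expanding the differences and permuting arguments
writes the estimator as a combination of five U-statistics of this kind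
(`cubicEstimator_eq_haarTriple`). Each is, almost surely, `a * b / (n(n-1)(n-2))` times the number
`T` of clustered triples, where `a ∣ b`. Only the bins of the observations matter, so expectations
become finite sums `prodExp`.

The central moments of `T` come from an Efron–Stein inequality for even moments
(`prodExp_pow_le_of_efronStein`). Resampling one index changes `T` only through the triples
containing it, so the sum of squared increments is controlled by squared degrees, and these by
`clusterWeight`: triples weighted by the cubed occupancy of their coarse bin. If the coarse bins
have probability at most `Q` and the fine ones at most `P`, with `n * Q` bounded, occupancies have
bounded moments, and induction on the power shows that the `m`-th moment of `clusterWeight` is `O((1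
+ n³PQ)^m)` (`exists_prodExp_binWeight_clusterWeight_le`).

With `s = ab/n³` and a density bounded by `F`, one has `n³PQ = F²/s`. After scaling, the central
moment of order `2m` is therefore `O((s² + s)^m)`. The products `ab` that occur are `k₁k₃`, `k₂k₂`
and `k₁k₂`, and the admissible levels make every `s` at most a constant times `k₃/n²`, itself
bounded. Lyapunov's inequality passes from even integer orders to `2q`. -/

noncomputable section

/-! ### Expectations over finite product spaces. -/

/-- Expectation of `F` when the coordinates are independent with weights `p`. -/
def prodExp {I J : Type*} [Fintype I] [DecidableEq I] [Fintype J] (p : J → ℝ)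
    (F : (I → J) → ℝ) : ℝ :=
  ∑ y, (∏ i, p (y i)) * F y

section ProdExp

variable {I J : Type*} [Fintype I] [DecidableEq I] [Fintype J] {p : J → ℝ}

theorem prodExp_mono (hp : ∀ j, 0 ≤ p j) {F G : (I → J) → ℝ} (h : ∀ y, F y ≤ G y) :
    prodExp p F ≤ prodExp p G :=
  Finset.sum_le_sum fun y _ =>
    mul_le_mul_of_nonneg_left (h y) (Finset.prod_nonneg fun _ _ => hp _)

theorem prodExp_add (F G : (I → J) → ℝ) :
    prodExp p (fun y => F y + G y) = prodExp p F + prodExp p G := by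
  simp [prodExp, mul_add, Finset.sum_add_distrib]

theorem prodExp_sub (F G : (I → J) → ℝ) :
    prodExp p (fun y => F y - G y) = prodExp p F - prodExp p G := by
  simp [prodExp, mul_sub, Finset.sum_sub_distrib]

theorem prodExp_const_mul (c : ℝ) (F : (I → J) → ℝ) :
    prodExp p (fun y => c * F y) = c * prodExp p F := by
  simp only [prodExp, Finset.mul_sum]
  exact Finset.sum_congr rfl fun y _ => by ring

theorem prodExp_sum {T : Type*} (s : Finset T) (F : T → (I → J) → ℝ) :
    prodExp p (fun y => ∑ t ∈ s, F t y) = ∑ t ∈ s, prodExp p (F t) := by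
  simp only [prodExp, Finset.mul_sum]
  exact Finset.sum_comm

theorem prodExp_const (h1 : ∑ j, p j = 1) (c : ℝ) :
    prodExp p (fun _ : I → J => c) = c := by
  have h : ∑ y : I → J, ∏ i, p (y i) = 1 := by
    have := (Finset.prod_univ_sum (fun _ : I => (Finset.univ : Finset J)) (fun _ j => p j)).symm
    simpa [h1] using this
  simp [prodExp, ← Finset.sum_mul, h]

theorem prodExp_comp_perm (σ : Equiv.Perm I) (F : (I → J) → ℝ) :
    prodExp p (fun y => F (y ∘ σ)) = prodExp p F := by
  unfold prodExp
  refine Fintype.sum_equiv (Equiv.arrowCongr σ.symm (Equiv.refl J)) _ _ fun y => ?_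
  have : (Equiv.arrowCongr σ.symm (Equiv.refl J)) y = y ∘ σ := by
    ext i; simp [Equiv.arrowCongr]
  rw [this]
  congr 1
  exact (Equiv.prod_comp σ fun i => p (y i)).symm

/-- Integrating out one coordinate does not change the expectation. -/
theorem prodExp_update (h1 : ∑ j, p j = 1) (i : I) (F : (I → J) → ℝ) :
    prodExp p (fun y => ∑ a, p a * F (Function.update y i a)) = prodExp p F := by
  -- Exchanging coordinate `i` with the auxiliary draw is an involution that preserves the joint
  -- weight; afterwards the auxiliary draw sums to one.
  have hinv : Function.Involutive
      (fun z : (I → J) × J => (Function.update z.1 i z.2, z.1 i)) := by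
    rintro ⟨y, a⟩
    simp
  have hw : ∀ (y : I → J) (a : J),
      (∏ k, p (y k)) * p a = (∏ k, p (Function.update y i a k)) * p (y i) := by
    intro y a
    rw [← Finset.mul_prod_erase _ _ (Finset.mem_univ i),
      ← Finset.mul_prod_erase _ (fun k => p (Function.update y i a k)) (Finset.mem_univ i)]
    have : ∏ k ∈ Finset.univ.erase i, p (Function.update y i a k)
        = ∏ k ∈ Finset.univ.erase i, p (y k) :=
      Finset.prod_congr rfl fun k hk => by
        rw [Function.update_of_ne (Finset.ne_of_mem_erase hk)]
    rw [this, Function.update_self]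
    ring
  calc prodExp p (fun y => ∑ a, p a * F (Function.update y i a))
      = ∑ z : (I → J) × J, (∏ k, p (Function.update z.1 i z.2 k)) * p (z.1 i)
          * F (Function.update z.1 i z.2) := by
        rw [Fintype.sum_prod_type]
        refine Finset.sum_congr rfl fun y _ => ?_
        rw [Finset.mul_sum]
        refine Finset.sum_congr rfl fun a _ => ?_
        rw [← hw]
        ring
    _ = ∑ z : (I → J) × J, (∏ k, p (z.1 k)) * p z.2 * F z.1 :=
        Fintype.sum_equiv hinv.toPerm _ _ fun z => by simp [Function.Involutive.toPerm]
    _ = prodExp p F := by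
        rw [Fintype.sum_prod_type]
        refine Finset.sum_congr rfl fun y _ => ?_
        show ∑ a, (∏ k, p (y k)) * p a * F y = (∏ k, p (y k)) * F y
        rw [← Finset.sum_mul, ← Finset.mul_sum, h1, mul_one]

/-- A bound on the expectation obtained by integrating out one coordinate. -/
theorem prodExp_le_of_update (hp : ∀ j, 0 ≤ p j) (h1 : ∑ j, p j = 1) (i : I) (c : ℝ)
    {F G : (I → J) → ℝ} (h : ∀ y, ∑ a, p a * F (Function.update y i a) ≤ c * G y) :
    prodExp p F ≤ c * prodExp p G := by
  rw [← prodExp_update h1 i F, ← prodExp_const_mul]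
  exact prodExp_mono hp h

theorem prodExp_mul_halves (F G : (I → J) → ℝ) :
    prodExp p (fun y : I ⊕ I → J => F (y ∘ Sum.inl) * G (y ∘ Sum.inr))
      = prodExp p F * prodExp p G := by
  unfold prodExp
  rw [Finset.sum_mul_sum, ← Fintype.sum_prod_type']
  refine Fintype.sum_equiv (Equiv.sumArrowEquivProdArrow I I J) _ _ fun y => ?_
  simp only [Fintype.prod_sum_type, Equiv.sumArrowEquivProdArrow, Equiv.coe_fn_mk,
    Function.comp_apply]
  ring

end ProdExp

/-! ### Efron–Stein inequality for even moments. -/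

section EfronStein

variable {ι J : Type*} [DecidableEq ι]

/-- The section of `ι ⊕ ι → ι` that takes the second copy exactly on `A`. -/
def mixSection (A : Finset ι) (i : ι) : ι ⊕ ι := if i ∈ A then Sum.inr i else Sum.inl i

theorem mixSection_injective (A : Finset ι) : Function.Injective (mixSection A) := by
  intro i j h
  unfold mixSection at h
  split_ifs at h <;> simp_all

theorem mixSection_empty : mixSection (∅ : Finset ι) = Sum.inl := by
  ext i; simp [mixSection]

theorem mixSection_univ [Fintype ι] : mixSection (Finset.univ : Finset ι) = Sum.inr := by
  ext i; simp [mixSection]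

/-- Adjacent hybrids of the sample and its independent copy are exchanged by a transposition, which
leaves the product law invariant. This is the symmetry behind the Efron–Stein argument. -/
theorem swap_comp_mixSection {A : Finset ι} {i : ι} (hi : i ∉ A) :
    Equiv.swap (Sum.inl i) (Sum.inr i) ∘ mixSection A = mixSection (insert i A) := by
  funext j
  by_cases hj : j = i
  · subst hj; simp [mixSection, hi]
  · by_cases hA : j ∈ A
    · simp only [Function.comp_apply, mixSection, hA, if_true, Finset.mem_insert, or_true]
      exact Equiv.swap_apply_of_ne_of_ne (by simp) (by simpa using hj)
    · simp only [Function.comp_apply, mixSection, hA, if_false, Finset.mem_insert, hj, or_false]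
      exact Equiv.swap_apply_of_ne_of_ne (by simpa using hj) (by simp)

theorem swap_comp_mixSection_insert {A : Finset ι} {i : ι} (hi : i ∉ A) :
    Equiv.swap (Sum.inl i) (Sum.inr i) ∘ mixSection (insert i A) = mixSection A := by
  rw [← swap_comp_mixSection hi, ← Function.comp_assoc]
  funext j
  simp

theorem abs_odd_pow_sub_le (m : ℕ) (a b : ℝ) :
    |a ^ (2 * m + 1) - b ^ (2 * m + 1)| ≤ (2 * m + 1) * (|a - b| * (a ^ (2 * m) + b ^ (2 * m))) := by
  have h := abs_pow_sub_pow_le a b (2 * m + 1)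
  have hm : max |a| |b| ^ (2 * m + 1 - 1) ≤ a ^ (2 * m) + b ^ (2 * m) := by
    have ha : 0 ≤ a ^ (2 * m) := by rw [pow_mul]; positivity
    have hb : 0 ≤ b ^ (2 * m) := by rw [pow_mul]; positivity
    rw [Nat.add_sub_cancel]
    rcases max_choice |a| |b| with h | h <;> rw [h, pow_mul, sq_abs, ← pow_mul] <;> linarith
  calc _ ≤ _ := h
    _ = (2 * m + 1) * (|a - b| * max |a| |b| ^ (2 * m + 1 - 1)) := by push_cast; ring
    _ ≤ _ := by gcongr

variable [Fintype ι] [Fintype J] {p : J → ℝ}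

/-- An Efron–Stein type inequality for even moments. -/
theorem prodExp_pow_le_efronStein (hp : ∀ j, 0 ≤ p j) (h1 : ∑ j, p j = 1)
    (Z : (ι → J) → ℝ) (hZ : prodExp p Z = 0) (e : ι → (ι ⊕ ι → J) → ℝ)
    (hswap : ∀ i y, e i (y ∘ Equiv.swap (Sum.inl i) (Sum.inr i)) = e i y)
    (hdiff : ∀ i A y, i ∉ A →
      (Z (y ∘ mixSection A) - Z (y ∘ mixSection (insert i A))) ^ 2 ≤ e i y) (m : ℕ) :
    prodExp p (fun x => Z x ^ (2 * m + 2)) ≤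
      (2 * m + 1) * prodExp p (fun y => (∑ i, e i y) * Z (y ∘ Sum.inl) ^ (2 * m)) := by
  have key : ∀ i A, i ∉ A →
      prodExp p (fun y => Z (y ∘ Sum.inl) ^ (2 * m + 1)
        * (Z (y ∘ mixSection A) - Z (y ∘ mixSection (insert i A)))) ≤
      (2 * m + 1) * prodExp p (fun y => e i y * Z (y ∘ Sum.inl) ^ (2 * m)) := by
    intro i A hi
    set τ : Equiv.Perm (ι ⊕ ι) := Equiv.swap (Sum.inl i) (Sum.inr i) with hτ
    have t1 : ∀ y : ι ⊕ ι → J, (y ∘ τ) ∘ mixSection A = y ∘ mixSection (insert i A) := fun y => by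
      rw [Function.comp_assoc, hτ, swap_comp_mixSection hi]
    have t2 : ∀ y : ι ⊕ ι → J, (y ∘ τ) ∘ mixSection (insert i A) = y ∘ mixSection A := fun y => by
      rw [Function.comp_assoc, hτ, swap_comp_mixSection_insert hi]
    have t3 : ∀ y : ι ⊕ ι → J, (y ∘ τ) ∘ Sum.inl = y ∘ mixSection (insert i ∅) := fun y => by
      rw [Function.comp_assoc, hτ, ← swap_comp_mixSection (Finset.notMem_empty i), mixSection_empty]
    have x1 := prodExp_comp_perm (p := p) τ (fun y => Z (y ∘ Sum.inl) ^ (2 * m + 1)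
        * (Z (y ∘ mixSection A) - Z (y ∘ mixSection (insert i A))))
    simp only [t1, t2, t3] at x1
    have x2 := prodExp_comp_perm (p := p) τ (fun y => e i y * Z (y ∘ Sum.inl) ^ (2 * m))
    simp only [t3, show ∀ y, e i (y ∘ τ) = e i y from hswap i] at x2
    -- By `x1` the two terms on the left have the same expectation. Their sum is `(a^(2m+1) -
    -- b^(2m+1)) * (u - v)`, a product of two increments, whereas each term alone contains only one.
    have x3 : prodExp p (fun y => Z (y ∘ Sum.inl) ^ (2 * m + 1)
          * (Z (y ∘ mixSection A) - Z (y ∘ mixSection (insert i A))))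
        + prodExp p (fun y => Z (y ∘ mixSection (insert i ∅)) ^ (2 * m + 1)
          * (Z (y ∘ mixSection (insert i A)) - Z (y ∘ mixSection A))) ≤
        (2 * m + 1) * (prodExp p (fun y => e i y * Z (y ∘ Sum.inl) ^ (2 * m))
          + prodExp p (fun y => e i y * Z (y ∘ mixSection (insert i ∅)) ^ (2 * m))) := by
      rw [← prodExp_add, ← prodExp_add, ← prodExp_const_mul]
      refine prodExp_mono hp fun y => ?_
      have d1 := hdiff i ∅ y (by simp)
      have d2 := hdiff i A y hi
      rw [mixSection_empty] at d1
      set a := Z (y ∘ Sum.inl)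
      set b := Z (y ∘ mixSection (insert i ∅))
      set u := Z (y ∘ mixSection A)
      set v := Z (y ∘ mixSection (insert i A))
      have ha : 0 ≤ a ^ (2 * m) := by rw [pow_mul]; positivity
      have hb : 0 ≤ b ^ (2 * m) := by rw [pow_mul]; positivity
      have hab : |a - b| * |u - v| ≤ e i y := by
        have := two_mul_le_add_sq |a - b| |u - v|
        rw [sq_abs, sq_abs] at this
        linarith
      calc a ^ (2 * m + 1) * (u - v) + b ^ (2 * m + 1) * (v - u)
          = (a ^ (2 * m + 1) - b ^ (2 * m + 1)) * (u - v) := by ring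
        _ ≤ |a ^ (2 * m + 1) - b ^ (2 * m + 1)| * |u - v| := by
            rw [← abs_mul]; exact le_abs_self _
        _ ≤ ((2 * m + 1) * (|a - b| * (a ^ (2 * m) + b ^ (2 * m)))) * |u - v| := by
            gcongr; exact abs_odd_pow_sub_le m a b
        _ = (2 * m + 1) * ((|a - b| * |u - v|) * (a ^ (2 * m) + b ^ (2 * m))) := by ring
        _ ≤ (2 * m + 1) * (e i y * (a ^ (2 * m) + b ^ (2 * m))) := by gcongr
        _ = _ := by ring
    rw [x1, x2] at x3
    linarith
  have tele : ∀ A : Finset ι,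
      prodExp p (fun y => Z (y ∘ Sum.inl) ^ (2 * m + 1)
        * (Z (y ∘ Sum.inl) - Z (y ∘ mixSection A))) ≤
      ∑ i ∈ A, (2 * m + 1) * prodExp p (fun y => e i y * Z (y ∘ Sum.inl) ^ (2 * m)) := by
    intro A
    induction A using Finset.induction_on with
    | empty => simp [mixSection_empty, prodExp]
    | insert i A hi ih =>
      rw [Finset.sum_insert hi]
      have : (fun y : ι ⊕ ι → J => Z (y ∘ Sum.inl) ^ (2 * m + 1)
          * (Z (y ∘ Sum.inl) - Z (y ∘ mixSection (insert i A)))) =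
          fun y => Z (y ∘ Sum.inl) ^ (2 * m + 1)
            * (Z (y ∘ mixSection A) - Z (y ∘ mixSection (insert i A)))
          + Z (y ∘ Sum.inl) ^ (2 * m + 1) * (Z (y ∘ Sum.inl) - Z (y ∘ mixSection A)) := by
        funext y; ring
      rw [this, prodExp_add]
      exact add_le_add (key i A hi) ih
  have h := tele Finset.univ
  rw [← Finset.mul_sum, ← prodExp_sum, mixSection_univ] at h
  simp only [← Finset.sum_mul] at h
  refine le_trans (le_of_eq ?_) h
  -- At the end of the telescope the second copy is independent of the first, so the centring of `Z`
  -- removes the cross term and leaves the even moment.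
  have e1 : (fun y : ι ⊕ ι → J => Z (y ∘ Sum.inl) ^ (2 * m + 1)
          * (Z (y ∘ Sum.inl) - Z (y ∘ Sum.inr))) =
      fun y => Z (y ∘ Sum.inl) ^ (2 * m + 2) * (fun _ => (1 : ℝ)) (y ∘ Sum.inr)
        - Z (y ∘ Sum.inl) ^ (2 * m + 1) * Z (y ∘ Sum.inr) := by
    funext y; ring
  rw [e1, prodExp_sub, prodExp_mul_halves (fun x => Z x ^ (2 * m + 2)) (fun _ => (1 : ℝ)),
    prodExp_mul_halves (fun x => Z x ^ (2 * m + 1)) Z, hZ, prodExp_const h1]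
  ring

/-- A Young-type inequality separates the increments from `Z`; half of the moment is absorbed on the
left, which explains the leading factor 2. -/
theorem prodExp_pow_le_of_efronStein (hp : ∀ j, 0 ≤ p j) (h1 : ∑ j, p j = 1)
    (Z : (ι → J) → ℝ) (hZ : prodExp p Z = 0) (e : ι → (ι ⊕ ι → J) → ℝ)
    (hswap : ∀ i y, e i (y ∘ Equiv.swap (Sum.inl i) (Sum.inr i)) = e i y)
    (hdiff : ∀ i A y, i ∉ A →
      (Z (y ∘ mixSection A) - Z (y ∘ mixSection (insert i A))) ^ 2 ≤ e i y) (m : ℕ) :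
    prodExp p (fun x => Z x ^ (2 * m + 2)) ≤
      2 * prodExp p (fun y => (2 * (2 * m + 1) * ∑ i, e i y) ^ (m + 1)) := by
  have h := prodExp_pow_le_efronStein hp h1 Z hZ e hswap hdiff m
  have young : ∀ (z S : ℝ), 0 ≤ S →
      S * z ^ (2 * m) ≤ 1 / 2 * z ^ (2 * m + 2) + (2 * S) ^ (m + 1) := by
    intro z S hS
    have hz : 0 ≤ z ^ (2 * m) := by rw [pow_mul]; positivity
    rcases le_total (2 * S) (z ^ 2) with hc | hc
    · have : S * z ^ (2 * m) ≤ 1 / 2 * z ^ (2 * m + 2) := by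
        rw [pow_add]; nlinarith
      have : 0 ≤ (2 * S) ^ (m + 1) := by positivity
      linarith
    · have h2 : z ^ (2 * m) ≤ (2 * S) ^ m := by
        rw [pow_mul]; gcongr
      have h3 : 0 ≤ z ^ (2 * m + 2) := by rw [pow_add]; positivity
      have h4 : S * z ^ (2 * m) ≤ (2 * S) * (2 * S) ^ m :=
        mul_le_mul (by linarith) h2 hz (by linarith)
      rw [pow_succ' (2 * S)]
      linarith
  have he : ∀ y, 0 ≤ ∑ i, e i y := fun y =>
    Finset.sum_nonneg fun i _ => (sq_nonneg _).trans (hdiff i ∅ y (by simp))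
  have hb : prodExp p (fun y => (2 * m + 1) * ((∑ i, e i y) * Z (y ∘ Sum.inl) ^ (2 * m))) ≤
      prodExp p (fun y => 1 / 2 * (Z (y ∘ Sum.inl) ^ (2 * m + 2) * (fun _ => (1 : ℝ)) (y ∘ Sum.inr))
        + (2 * (2 * m + 1) * ∑ i, e i y) ^ (m + 1)) := by
    refine prodExp_mono hp fun y => ?_
    have := young (Z (y ∘ Sum.inl)) ((2 * m + 1) * ∑ i, e i y) (mul_nonneg (by positivity) (he y))
    calc _ = _ := (mul_assoc _ _ _).symm
      _ ≤ _ := this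
      _ = _ := by ring
  rw [prodExp_const_mul, prodExp_add, prodExp_const_mul,
    prodExp_mul_halves (fun x => Z x ^ (2 * m + 2)) (fun _ => (1 : ℝ)), prodExp_const h1] at hb
  linarith

end EfronStein

/-! ### Clustered triples and bin occupancies. -/

section Triples

variable {I J B : Type*} [DecidableEq I] [DecidableEq J] [DecidableEq B]

set_option linter.unusedSectionVars false

/-- Indicator that the three indices of `t` are distinct, that all three observations lie in the
same coarse bin and that the last two lie in the same fine bin. -/
def tripleInd (π : J → B) (x : I → J) (t : I × I × I) : ℝ :=
  if (t.1 ≠ t.2.1 ∧ t.1 ≠ t.2.2 ∧ t.2.1 ≠ t.2.2) ∧ π (x t.1) = π (x t.2.2) ∧ x t.2.1 = x t.2.2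
  then 1 else 0

/-- One plus the number of observations with index in `s` in the coarse bin `b`. -/
def binWeight (π : J → B) (s : Finset I) (y : I → J) (b : B) : ℝ :=
  1 + ∑ i ∈ s, if π (y i) = b then 1 else 0

/-- One plus the number of clustered triples with indices in `s`, weighted by their coarse bin. -/
def clusterWeight (π : J → B) (s : Finset I) (y : I → J) : ℝ :=
  1 + ∑ t ∈ s ×ˢ s ×ˢ s, tripleInd π y t * binWeight π s y (π (y t.2.2)) ^ 3

theorem tripleInd_nonneg (π : J → B) (x : I → J) (t : I × I × I) : 0 ≤ tripleInd π x t := by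
  unfold tripleInd; split_ifs <;> norm_num

theorem tripleInd_comp {I' : Type*} [DecidableEq I'] (π : J → B) (y : I' → J) {s : I → I'}
    (hs : Function.Injective s) (t : I × I × I) :
    tripleInd π (y ∘ s) t = tripleInd π y (s t.1, s t.2.1, s t.2.2) := by
  simp [tripleInd, hs.eq_iff]

theorem tripleInd_ne_zero {π : J → B} {x : I → J} {t : I × I × I} (h : tripleInd π x t ≠ 0) :
    (t.1 ≠ t.2.1 ∧ t.1 ≠ t.2.2 ∧ t.2.1 ≠ t.2.2) ∧ π (x t.1) = π (x t.2.2) ∧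
      x t.2.1 = x t.2.2 := by
  by_contra hc
  exact h (if_neg hc)

theorem tripleInd_eq_one {π : J → B} {x : I → J} {t : I × I × I} (h : tripleInd π x t ≠ 0) :
    tripleInd π x t = 1 :=
  if_pos (tripleInd_ne_zero h)

theorem one_le_binWeight (π : J → B) (s : Finset I) (y : I → J) (b : B) :
    1 ≤ binWeight π s y b :=
  le_add_of_nonneg_right (Finset.sum_nonneg fun _ _ => by split_ifs <;> norm_num)

theorem binWeight_mono (π : J → B) {s s' : Finset I} (h : s ⊆ s') (y : I → J) (b : B) :
    binWeight π s y b ≤ binWeight π s' y b :=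
  add_le_add_right (Finset.sum_le_sum_of_subset_of_nonneg h
    fun _ _ _ => by split_ifs <;> norm_num) 1

theorem binWeight_le_add_card (π : J → B) {s s' : Finset I} (h : s ⊆ s') (y : I → J) (b : B) :
    binWeight π s' y b ≤ binWeight π s y b + (s' \ s).card := by
  unfold binWeight
  rw [← Finset.sum_sdiff h]
  have : ∑ i ∈ s' \ s, (if π (y i) = b then (1 : ℝ) else 0) ≤ ∑ i ∈ s' \ s, 1 :=
    Finset.sum_le_sum fun _ _ => by split_ifs <;> norm_num
  rw [Finset.sum_const, nsmul_eq_mul, mul_one] at this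
  linarith

theorem binWeight_update (π : J → B) {s : Finset I} (y : I → J) (b : B) {i : I} (hi : i ∉ s)
    (a : J) : binWeight π s (Function.update y i a) b = binWeight π s y b := by
  unfold binWeight
  congr 1
  refine Finset.sum_congr rfl fun k hk => ?_
  rw [Function.update_of_ne (ne_of_mem_of_not_mem hk hi)]

theorem one_le_clusterWeight (π : J → B) (s : Finset I) (y : I → J) :
    1 ≤ clusterWeight π s y :=
  le_add_of_nonneg_right (Finset.sum_nonneg fun _ _ => mul_nonneg (tripleInd_nonneg _ _ _)
    (pow_nonneg (zero_le_one.trans (one_le_binWeight _ _ _ _)) _))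

theorem clusterWeight_mono (π : J → B) {s s' : Finset I} (h : s ⊆ s') (y : I → J) :
    clusterWeight π s y ≤ clusterWeight π s' y := by
  have hb : ∀ (s : Finset I) (b : B), 0 ≤ binWeight π s y b := fun s b =>
    zero_le_one.trans (one_le_binWeight _ _ _ _)
  refine add_le_add_right ?_ 1
  calc _ ≤ ∑ t ∈ s ×ˢ s ×ˢ s, tripleInd π y t * binWeight π s' y (π (y t.2.2)) ^ 3 := by
        refine Finset.sum_le_sum fun t _ => ?_
        have := binWeight_mono π h y (π (y t.2.2))
        have := hb s (π (y t.2.2))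
        have := tripleInd_nonneg π y t
        gcongr
    _ ≤ _ := Finset.sum_le_sum_of_subset_of_nonneg
        (Finset.product_subset_product h (Finset.product_subset_product h h))
        fun t _ _ => mul_nonneg (tripleInd_nonneg _ _ _) (pow_nonneg (hb _ _) _)

theorem clusterWeight_update (π : J → B) {s : Finset I} (y : I → J) {i : I} (hi : i ∉ s)
    (a : J) : clusterWeight π s (Function.update y i a) = clusterWeight π s y := by
  unfold clusterWeight
  congr 1
  refine Finset.sum_congr rfl fun t ht => ?_
  simp only [Finset.mem_product] at ht
  have h1 := ne_of_mem_of_not_mem ht.1 hi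
  have h2 := ne_of_mem_of_not_mem ht.2.1 hi
  have h3 := ne_of_mem_of_not_mem ht.2.2 hi
  simp only [tripleInd, Function.update_of_ne h1, Function.update_of_ne h2,
    Function.update_of_ne h3, binWeight_update π y _ hi]

variable [Fintype I]

/-- The number of clustered triples in the coarse bin `b` is at most the cube of its count. -/
theorem sum_tripleInd_bin_le (π : J → B) (y : I → J) (b : B) :
    ∑ t : I × I × I, (if π (y t.2.2) = b then tripleInd π y t else 0)
      ≤ binWeight π Finset.univ y b ^ 3 := by
  have hq : ∀ i : I, (0 : ℝ) ≤ if π (y i) = b then 1 else 0 := fun i => by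
    split_ifs <;> norm_num
  have h1 : ∑ t : I × I × I, (if π (y t.2.2) = b then tripleInd π y t else 0) ≤
      (∑ i, if π (y i) = b then (1 : ℝ) else 0) ^ 3 := by
    have : (∑ i, if π (y i) = b then (1 : ℝ) else 0) ^ 3 =
        ∑ t : I × I × I, (if π (y t.1) = b then (1 : ℝ) else 0) *
          ((if π (y t.2.1) = b then (1 : ℝ) else 0) * (if π (y t.2.2) = b then (1 : ℝ) else 0)) := by
      rw [pow_succ', pow_two, Finset.sum_mul_sum, ← Fintype.sum_prod_type', Finset.sum_mul_sum,
        ← Fintype.sum_prod_type']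
    rw [this]
    refine Finset.sum_le_sum fun t _ => ?_
    by_cases hb : π (y t.2.2) = b
    · by_cases ht : tripleInd π y t = 0
      · rw [ht, ite_self]
        exact mul_nonneg (hq _) (mul_nonneg (hq _) (hq _))
      · obtain ⟨-, h1, h2⟩ := tripleInd_ne_zero ht
        rw [if_pos hb, tripleInd_eq_one ht, h2, h1, hb]
        simp
    · rw [if_neg hb]
      exact mul_nonneg (hq _) (mul_nonneg (hq _) (hq _))
  refine h1.trans (pow_le_pow_left₀ (Finset.sum_nonneg fun i _ => hq i) ?_ 3)
  unfold binWeight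
  linarith

/-- Three indices add at most 3 to a weight that is at least 1. The built-in 1 thus makes the
removal of a triple a multiplicative loss, and frees the weight from the removed coordinates. -/
theorem binWeight_univ_le (π : J → B) (y : I → J) (b : B) (u : Finset I) (hu : u.card ≤ 3) :
    binWeight π Finset.univ y b ≤ 4 * binWeight π uᶜ y b := by
  have h := binWeight_le_add_card π (Finset.subset_univ uᶜ) y b
  have hc : ((Finset.univ \ uᶜ).card : ℝ) ≤ 3 := by
    rw [← Finset.compl_eq_univ_sdiff, compl_compl]
    exact_mod_cast hu
  have := one_le_binWeight π uᶜ y b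
  linarith

/-- Triples outside `b` avoid `u`, and their bins have the same occupancy without `u`. Triples in
`b` number at most the cube of its weight and each carries another cube, whence the sixth power.
Sums become products because all weights are at least 1. -/
theorem clusterWeight_univ_le (π : J → B) (y : I → J) (b : B) (u : Finset I) (hu : u.card ≤ 3)
    (hb : ∀ i ∈ u, π (y i) = b) :
    clusterWeight π Finset.univ y ≤
      2 * 4 ^ 6 * (clusterWeight π uᶜ y * binWeight π uᶜ y b ^ 6) := by
  have hM := one_le_binWeight π uᶜ y b
  have hM1 := one_le_binWeight π Finset.univ y b
  have hW := one_le_clusterWeight π uᶜ y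
  have hsplit : clusterWeight π Finset.univ y ≤
      clusterWeight π uᶜ y + binWeight π Finset.univ y b ^ 6 := by
    have e1 : ∀ t : I × I × I, tripleInd π y t * binWeight π Finset.univ y (π (y t.2.2)) ^ 3 ≤
        (if t ∈ uᶜ ×ˢ uᶜ ×ˢ uᶜ then tripleInd π y t * binWeight π uᶜ y (π (y t.2.2)) ^ 3 else 0)
          + (if π (y t.2.2) = b then tripleInd π y t else 0)
            * binWeight π Finset.univ y b ^ 3 := by
      intro t
      have h0 := tripleInd_nonneg π y t
      have hpos : 0 ≤ (if t ∈ uᶜ ×ˢ uᶜ ×ˢ uᶜ then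
          tripleInd π y t * binWeight π uᶜ y (π (y t.2.2)) ^ 3 else 0) := by
        split_ifs
        · exact mul_nonneg h0 (pow_nonneg (zero_le_one.trans (one_le_binWeight _ _ _ _)) _)
        · exact le_rfl
      by_cases ht : tripleInd π y t = 0
      · simp [ht]
      by_cases hc : π (y t.2.2) = b
      · rw [if_pos hc, hc]
        rw [hc] at hpos
        linarith
      · obtain ⟨-, h1, h2⟩ := tripleInd_ne_zero ht
        have m3 : t.2.2 ∈ uᶜ := by
          rw [Finset.mem_compl]; exact fun h => hc (hb _ h)
        have m2 : t.2.1 ∈ uᶜ := by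
          rw [Finset.mem_compl]; exact fun h => hc (by rw [← h2]; exact hb _ h)
        have m1 : t.1 ∈ uᶜ := by
          rw [Finset.mem_compl]; exact fun h => hc (by rw [← h1]; exact hb _ h)
        have hbin : binWeight π Finset.univ y (π (y t.2.2)) =
            binWeight π uᶜ y (π (y t.2.2)) := by
          unfold binWeight
          congr 1
          symm
          refine Finset.sum_subset (Finset.subset_univ _) fun i _ hi => ?_
          rw [Finset.mem_compl, not_not] at hi
          rw [if_neg]
          rw [hb i hi]
          exact fun h => hc h.symm
        rw [if_neg hc, if_pos (by simp only [Finset.mem_product]; exact ⟨m1, m2, m3⟩), hbin]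
        simp
    have e2 := Finset.sum_le_sum fun t (_ : t ∈ (Finset.univ : Finset (I × I × I))) => e1 t
    rw [Finset.sum_add_distrib, ← Finset.sum_mul, Finset.sum_ite_mem, Finset.univ_inter] at e2
    have e3 := mul_le_mul_of_nonneg_right (sum_tripleInd_bin_le π y b)
      (pow_nonneg (zero_le_one.trans hM1) 3)
    unfold clusterWeight
    simp only [Finset.univ_product_univ]
    rw [← pow_add] at e3
    norm_num at e3
    linarith
  have h4 : binWeight π Finset.univ y b ^ 6 ≤ 4 ^ 6 * binWeight π uᶜ y b ^ 6 := by
    rw [← mul_pow]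
    exact pow_le_pow_left₀ (by linarith) (binWeight_univ_le π y b u hu) 6
  have h5 : 1 ≤ binWeight π uᶜ y b ^ 6 := one_le_pow₀ hM
  generalize binWeight π uᶜ y b ^ 6 = v at *
  generalize clusterWeight π uᶜ y = w at *
  nlinarith

end Triples

/-! ### Moments of the occupancy and cluster weights. -/

/-- Weights `p` on the fine bins with fine bin probabilities at most `P` and coarse bin
probabilities at most `Q`. -/
structure BinLaw {J B : Type*} [Fintype J] [DecidableEq B] (p : J → ℝ) (π : J → B) (P Q : ℝ) :
    Prop where
  nonneg : ∀ j, 0 ≤ p j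
  sum_eq_one : ∑ j, p j = 1
  le_fine : ∀ j, p j ≤ P
  le_coarse : ∀ b, ∑ j, p j * (if π j = b then 1 else 0) ≤ Q

section Moments

variable {I J B : Type*} [Fintype I] [Fintype J] [DecidableEq I] [DecidableEq J] [DecidableEq B]
  {p : J → ℝ} {π : J → B} {P Q : ℝ}

theorem BinLaw.fine_nonneg (h : BinLaw p π P Q) : 0 ≤ P := by
  by_contra hc
  have : ∑ j, p j ≤ 0 := Finset.sum_nonpos fun j _ => (h.le_fine j).trans (not_le.1 hc).le
  rw [h.sum_eq_one] at this
  linarith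

theorem BinLaw.coarse_nonneg (h : BinLaw p π P Q) (b : B) : 0 ≤ Q :=
  (Finset.sum_nonneg fun j _ => mul_nonneg (h.nonneg j) (by split_ifs <;> norm_num)).trans
    (h.le_coarse b)

theorem BinLaw.coarse_nonneg' (h : BinLaw p π P Q) : 0 ≤ Q := by
  have : Nonempty J := by
    by_contra hc
    rw [not_nonempty_iff] at hc
    simpa using h.sum_eq_one
  exact h.coarse_nonneg (π (Classical.arbitrary J))

/-- One factor is expanded as a sum over indices. For each index the remaining factors are bounded,
up to `4 ^ r`, by weights that omit it, so its indicator integrates to at most `Q`. -/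
theorem prodExp_binWeight_pow_succ_le (h : BinLaw p π P Q) (b : B) (r : ℕ) :
    prodExp p (fun y : I → J => binWeight π Finset.univ y b ^ (r + 1)) ≤
      (1 + Fintype.card I * Q * 4 ^ r) *
        prodExp p (fun y : I → J => binWeight π Finset.univ y b ^ r) := by
  have e : (fun y : I → J => binWeight π Finset.univ y b ^ (r + 1)) = fun y =>
      binWeight π Finset.univ y b ^ r +
        ∑ i, (if π (y i) = b then 1 else 0) * binWeight π Finset.univ y b ^ r := by
    funext y
    rw [← Finset.sum_mul, pow_succ', ← one_add_mul]
    rfl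
  have hi : ∀ i : I, prodExp p (fun y : I → J =>
      (if π (y i) = b then 1 else 0) * binWeight π Finset.univ y b ^ r) ≤
      Q * 4 ^ r * prodExp p (fun y : I → J => binWeight π Finset.univ y b ^ r) := by
    intro i
    refine prodExp_le_of_update h.nonneg h.sum_eq_one i _ fun y => ?_
    have hm := binWeight_mono π (Finset.subset_univ ({i}ᶜ : Finset I)) y b
    have h1 := one_le_binWeight π ({i}ᶜ : Finset I) y b
    calc _ ≤ ∑ a, p a * (if π a = b then 1 else 0) *
          (4 ^ r * binWeight π Finset.univ y b ^ r) := by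
          refine Finset.sum_le_sum fun a _ => ?_
          rw [Function.update_self, ← mul_assoc]
          refine mul_le_mul_of_nonneg_left ?_
            (mul_nonneg (h.nonneg a) (by split_ifs <;> norm_num))
          rw [← mul_pow]
          refine pow_le_pow_left₀ (zero_le_one.trans (one_le_binWeight _ _ _ _)) ?_ r
          refine (binWeight_univ_le π _ b {i} (by simp)).trans ?_
          rw [binWeight_update π y b (by simp)]
          linarith
      _ ≤ Q * (4 ^ r * binWeight π Finset.univ y b ^ r) := by
          rw [← Finset.sum_mul]
          refine mul_le_mul_of_nonneg_right (h.le_coarse b) ?_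
          have : 0 ≤ binWeight π Finset.univ y b := by linarith
          positivity
      _ = _ := by ring
  rw [e, prodExp_add, prodExp_sum]
  have := Finset.sum_le_sum fun i (_ : i ∈ (Finset.univ : Finset I)) => hi i
  rw [Finset.sum_const, Finset.card_univ, nsmul_eq_mul] at this
  linarith

/-- Given `y k`, integrating out `i` costs `Q` and integrating out `j` costs `P`. The bin left over
is that of `y k`, hence random, so the bound `K` must be uniform in the bin. -/
theorem prodExp_tripleInd_mul_le (h : BinLaw p π P Q) {i j k : I} (hij : i ≠ j) (hik : i ≠ k)
    (hjk : j ≠ k) (H : B → (I → J) → ℝ) (hH : ∀ b y, 0 ≤ H b y)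
    (hi : ∀ b y a, H b (Function.update y i a) = H b y)
    (hj : ∀ b y a, H b (Function.update y j a) = H b y)
    (hk : ∀ b y a, H b (Function.update y k a) = H b y)
    (K : ℝ) (hK : ∀ b, prodExp p (H b) ≤ K) :
    prodExp p (fun y => tripleInd π y (i, j, k) * H (π (y k)) y) ≤ Q * P * K := by
  have hP := h.fine_nonneg
  have hQ := h.coarse_nonneg'
  have s1 : prodExp p (fun y => tripleInd π y (i, j, k) * H (π (y k)) y) ≤
      Q * prodExp p (fun y => (if y j = y k then 1 else 0) * H (π (y k)) y) := by
    refine prodExp_le_of_update h.nonneg h.sum_eq_one i _ fun y => ?_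
    have : ∀ a, p a * (tripleInd π (Function.update y i a) (i, j, k) *
        H (π (Function.update y i a k)) (Function.update y i a)) =
        (p a * (if π a = π (y k) then 1 else 0)) *
          ((if y j = y k then 1 else 0) * H (π (y k)) y) := by
      intro a
      rw [hi, Function.update_of_ne hik.symm]
      simp only [tripleInd, Function.update_self, Function.update_of_ne hik.symm,
        Function.update_of_ne hij.symm]
      simp only [ne_eq, hij, hik, hjk, not_false_eq_true, and_self, true_and, ite_and]
      split_ifs <;> ring
    simp_rw [this]
    rw [← Finset.sum_mul]
    exact mul_le_mul_of_nonneg_right (h.le_coarse _)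
      (mul_nonneg (by split_ifs <;> norm_num) (hH _ _))
  have s2 : prodExp p (fun y => (if y j = y k then 1 else 0) * H (π (y k)) y) ≤
      P * prodExp p (fun y => H (π (y k)) y) := by
    refine prodExp_le_of_update h.nonneg h.sum_eq_one j _ fun y => ?_
    have : ∀ a, p a * ((if Function.update y j a j = Function.update y j a k then 1 else 0) *
        H (π (Function.update y j a k)) (Function.update y j a)) =
        (p a * (if a = y k then 1 else 0)) * H (π (y k)) y := by
      intro a
      rw [hj, Function.update_of_ne hjk.symm, Function.update_self, mul_assoc]
    simp_rw [this]
    rw [← Finset.sum_mul]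
    refine mul_le_mul_of_nonneg_right ?_ (hH _ _)
    simpa using h.le_fine (y k)
  have s3 : prodExp p (fun y => H (π (y k)) y) ≤ K := by
    rw [← prodExp_update h.sum_eq_one k]
    simp only [hk, Function.update_self]
    rw [prodExp_sum]
    simp_rw [prodExp_const_mul]
    calc _ ≤ ∑ a, p a * K := Finset.sum_le_sum fun a _ =>
          mul_le_mul_of_nonneg_left (hK _) (h.nonneg a)
      _ = K := by rw [← Finset.sum_mul, h.sum_eq_one, one_mul]
  calc _ ≤ _ := s1
    _ ≤ Q * (P * K) := by gcongr; exact s2.trans (by gcongr)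
    _ = _ := by ring

end Moments

/-- Expanding one factor of `clusterWeight` gives a sum over triples; each triple is decoupled from
the other factors by dropping its indices and then contributes `P * Q`. Decoupling turns cluster
weights into extra powers of the occupancy, so the induction on `m` has to carry an arbitrary power
`r`. -/
theorem exists_prodExp_binWeight_clusterWeight_le (D : ℝ) (m : ℕ) : ∀ r : ℕ, ∃ C : ℝ, 0 ≤ C ∧
    ∀ (I J B : Type) [Fintype I] [Fintype J] [DecidableEq I] [DecidableEq J] [DecidableEq B]
      (p : J → ℝ) (π : J → B) (P Q : ℝ), BinLaw p π P Q → Fintype.card I * Q ≤ D → ∀ b,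
      prodExp p (fun y : I → J =>
        binWeight π Finset.univ y b ^ r * clusterWeight π Finset.univ y ^ m) ≤
        C * (1 + (Fintype.card I : ℝ) ^ 3 * (P * Q)) ^ m := by
  induction m with
  | zero =>
    intro r
    induction r with
    | zero =>
      refine ⟨1, zero_le_one, ?_⟩
      intro I J B _ _ _ _ _ p π P Q h _ b
      simp [prodExp_const h.sum_eq_one]
    | succ r ih =>
      obtain ⟨C, hC, ih⟩ := ih
      refine ⟨(1 + |D| * 4 ^ r) * C, by positivity, ?_⟩
      intro I J B _ _ _ _ _ p π P Q h hD b
      have h1 := ih I J B p π P Q h hD b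
      have h2 := prodExp_binWeight_pow_succ_le (I := I) h b r
      simp only [pow_zero, mul_one] at h1 ⊢
      have h3 := h.coarse_nonneg b
      calc _ ≤ _ := h2
        _ ≤ (1 + Fintype.card I * Q * 4 ^ r) * C := by gcongr
        _ ≤ _ := by gcongr; exact hD.trans (le_abs_self D)
  | succ m ih =>
    intro r
    obtain ⟨C0, hC0, ih0⟩ := ih r
    obtain ⟨C1, hC1, ih1⟩ := ih (3 + r + 6 * m)
    -- The costs of dropping the triple's indices: `4 ^ 3` from its own cubed occupancy, `4 ^ r`
    -- from the bin `b`, and `2 * 4 ^ 6` from each of the `m` cluster weights, which also yields a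
    -- sixth power of occupancy.
    set c : ℝ := 4 ^ 3 * 4 ^ r * (2 * 4 ^ 6) ^ m with hc
    refine ⟨C0 + 2 * c * C1, by positivity, ?_⟩
    intro I J B _ _ _ _ _ p π P Q h hD b
    have hP := h.fine_nonneg
    have hQ := h.coarse_nonneg b
    set lam : ℝ := 1 + (Fintype.card I : ℝ) ^ 3 * (P * Q) with hlam
    have hlam1 : 1 ≤ lam := le_add_of_nonneg_right (by positivity)
    have h0 := ih0 I J B p π P Q h hD b
    have h1 := ih1 I J B p π P Q h hD
    have e : (fun y : I → J => binWeight π Finset.univ y b ^ r *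
          clusterWeight π Finset.univ y ^ (m + 1)) = fun y =>
        binWeight π Finset.univ y b ^ r * clusterWeight π Finset.univ y ^ m +
        ∑ t : I × I × I, tripleInd π y t * (binWeight π Finset.univ y (π (y t.2.2)) ^ 3 *
          (binWeight π Finset.univ y b ^ r * clusterWeight π Finset.univ y ^ m)) := by
      funext y
      simp_rw [← mul_assoc (tripleInd _ _ _)]
      rw [← Finset.sum_mul, ← one_add_mul]
      conv_lhs => rw [pow_succ, ← mul_assoc, mul_comm]
      congr 1
    have ht : ∀ t : I × I × I, prodExp p (fun y : I → J => tripleInd π y t *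
        (binWeight π Finset.univ y (π (y t.2.2)) ^ 3 *
          (binWeight π Finset.univ y b ^ r * clusterWeight π Finset.univ y ^ m))) ≤
        Q * P * (2 * c * C1 * lam ^ m) := by
      rintro ⟨i, j, k⟩
      by_cases hd : i ≠ j ∧ i ≠ k ∧ j ≠ k
      swap
      · have : ∀ y : I → J, tripleInd π y (i, j, k) = 0 := fun y => by
          unfold tripleInd; exact if_neg fun hh => hd hh.1
        simp only [this, zero_mul]
        rw [prodExp_const h.sum_eq_one]
        positivity
      obtain ⟨hij, hik, hjk⟩ := hd
      set u : Finset I := {i, j, k} with hu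
      have hcard : u.card ≤ 3 := Finset.card_le_three
      have hui : i ∉ uᶜ := by simp [hu]
      have huj : j ∉ uᶜ := by simp [hu]
      have huk : k ∉ uᶜ := by simp [hu]
      set H : B → (I → J) → ℝ := fun b' y =>
        c * (binWeight π uᶜ y b' ^ (3 + r + 6 * m) * clusterWeight π uᶜ y ^ m
          + binWeight π uᶜ y b ^ (3 + r + 6 * m) * clusterWeight π uᶜ y ^ m) with hH
      have hH0 : ∀ b' y, 0 ≤ H b' y := fun b' y => by
        have h1 := one_le_binWeight π uᶜ y b'
        have h2 := one_le_binWeight π uᶜ y b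
        have h3 := one_le_clusterWeight π uᶜ y
        have h1 := zero_le_one.trans h1
        have h2 := zero_le_one.trans h2
        have h3 := zero_le_one.trans h3
        simp only [hH]
        positivity
      refine le_trans (prodExp_mono h.nonneg (G := fun y =>
        tripleInd π y (i, j, k) * H (π (y k)) y) fun y => ?_) ?_
      · by_cases hz : tripleInd π y (i, j, k) = 0
        · simp [hz]
        refine mul_le_mul_of_nonneg_left ?_ (tripleInd_nonneg _ _ _)
        obtain ⟨-, g1, g2⟩ := tripleInd_ne_zero hz
        dsimp only at g1 g2 ⊢
        have hb : ∀ i' ∈ u, π (y i') = π (y k) := by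
          intro i' hi'
          simp only [hu, Finset.mem_insert, Finset.mem_singleton] at hi'
          rcases hi' with rfl | rfl | rfl
          · exact g1
          · rw [g2]
          · rfl
        have k1 := binWeight_univ_le π y (π (y k)) u hcard
        have k2 := binWeight_univ_le π y b u hcard
        have k3 := clusterWeight_univ_le π y (π (y k)) u hcard hb
        have p1 := zero_le_one.trans (one_le_binWeight π Finset.univ y (π (y k)))
        have p2 := zero_le_one.trans (one_le_binWeight π Finset.univ y b)
        have p3 := zero_le_one.trans (one_le_clusterWeight π Finset.univ y)
        have q1 := one_le_binWeight π uᶜ y (π (y k))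
        have q2 := one_le_binWeight π uᶜ y b
        have q3 := one_le_clusterWeight π uᶜ y
        simp only [hH]
        generalize binWeight π uᶜ y (π (y k)) = v1 at *
        generalize binWeight π uᶜ y b = v2 at *
        generalize clusterWeight π uᶜ y = w at *
        have q1' := zero_le_one.trans q1
        have q2' := zero_le_one.trans q2
        have q3' := zero_le_one.trans q3
        -- The triple's bin and `b` may differ; the mixed product is at most the sum of the two pure
        -- powers, so a one-bin induction hypothesis suffices.
        have hmix : v1 ^ (3 + 6 * m) * v2 ^ r ≤ v1 ^ (3 + r + 6 * m) + v2 ^ (3 + r + 6 * m) := by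
          rcases le_total v1 v2 with hv | hv
          · calc v1 ^ (3 + 6 * m) * v2 ^ r ≤ v2 ^ (3 + 6 * m) * v2 ^ r := by gcongr
              _ = v2 ^ (3 + r + 6 * m) := by rw [← pow_add]; congr 1; ring
              _ ≤ _ := le_add_of_nonneg_left (by positivity)
          · calc v1 ^ (3 + 6 * m) * v2 ^ r ≤ v1 ^ (3 + 6 * m) * v1 ^ r := by gcongr
              _ = v1 ^ (3 + r + 6 * m) := by rw [← pow_add]; congr 1; ring
              _ ≤ _ := le_add_of_nonneg_right (by positivity)
        calc _ ≤ (4 * v1) ^ 3 * ((4 * v2) ^ r * (2 * 4 ^ 6 * (w * v1 ^ 6)) ^ m) := by gcongr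
          _ = c * ((v1 ^ (3 + 6 * m) * v2 ^ r) * w ^ m) := by
              rw [hc, pow_add, pow_mul]; simp only [mul_pow]; ring
          _ ≤ c * ((v1 ^ (3 + r + 6 * m) + v2 ^ (3 + r + 6 * m)) * w ^ m) := by gcongr
          _ = _ := by ring
      · have hupd : ∀ i' ∉ uᶜ, ∀ b' y a, H b' (Function.update y i' a) = H b' y := by
          intro i' hi' b' y a
          simp only [hH, binWeight_update π y _ hi', clusterWeight_update π y hi']
        refine prodExp_tripleInd_mul_le h hij hik hjk H hH0 (hupd i hui) (hupd j huj) (hupd k huk)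
          _ fun b' => ?_
        have hmono : ∀ b'', prodExp p (fun y : I → J =>
            binWeight π uᶜ y b'' ^ (3 + r + 6 * m) * clusterWeight π uᶜ y ^ m) ≤
            C1 * lam ^ m := by
          intro b''
          refine le_trans (prodExp_mono h.nonneg fun y => ?_) (h1 b'')
          have := binWeight_mono π (Finset.subset_univ uᶜ) y b''
          have := clusterWeight_mono π (Finset.subset_univ uᶜ) y
          have p1 := zero_le_one.trans (one_le_binWeight π uᶜ y b'')
          have p2 := zero_le_one.trans (one_le_clusterWeight π uᶜ y)
          have p3 := zero_le_one.trans (one_le_binWeight π Finset.univ y b'')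
          gcongr
        simp only [hH]
        rw [prodExp_const_mul, prodExp_add]
        calc _ ≤ c * (C1 * lam ^ m + C1 * lam ^ m) := by
              gcongr
              · exact hmono b'
              · exact hmono b
          _ = _ := by ring
    rw [e, prodExp_add, prodExp_sum]
    have hs := Finset.sum_le_sum fun t (_ : t ∈ (Finset.univ : Finset (I × I × I))) => ht t
    rw [Finset.sum_const, Finset.card_univ, nsmul_eq_mul] at hs
    have hcardI : (Fintype.card (I × I × I) : ℝ) = (Fintype.card I : ℝ) ^ 3 := by
      simp only [Fintype.card_prod]; push_cast; ring
    rw [hcardI] at hs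
    have hx : (Fintype.card I : ℝ) ^ 3 * (P * Q) = lam - 1 := by rw [hlam]; ring
    have hl0 : 0 ≤ lam := zero_le_one.trans hlam1
    calc _ ≤ C0 * lam ^ m + (Fintype.card I : ℝ) ^ 3 * (Q * P * (2 * c * C1 * lam ^ m)) :=
          add_le_add h0 hs
      _ = C0 * lam ^ m * 1 + (lam - 1) * (2 * c * C1 * lam ^ m) := by rw [← hx]; ring
      _ ≤ C0 * lam ^ m * lam + lam * (2 * c * C1 * lam ^ m) := by
          gcongr
          linarith
      _ = _ := by ring

/-! ### Central moments of the number of clustered triples. -/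

section TripleCount

variable {I J B : Type*} [DecidableEq I] [DecidableEq J] [DecidableEq B] [Fintype I]

/-- The number of clustered triples. -/
def tripleCount (π : J → B) (x : I → J) : ℝ := ∑ t : I × I × I, tripleInd π x t

/-- The number of clustered triples that contain the index `i`. -/
def tripleDegree (π : J → B) (x : I → J) (i : I) : ℝ :=
  ∑ t : I × I × I, if t.1 = i ∨ t.2.1 = i ∨ t.2.2 = i then tripleInd π x t else 0

theorem tripleDegree_nonneg (π : J → B) (x : I → J) (i : I) : 0 ≤ tripleDegree π x i :=
  Finset.sum_nonneg fun t _ => by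
    split_ifs
    · exact tripleInd_nonneg _ _ _
    · exact le_rfl

theorem tripleDegree_comp_perm (π : J → B) (y : I → J) (σ : Equiv.Perm I) (i : I) :
    tripleDegree π (y ∘ σ) i = tripleDegree π y (σ i) := by
  unfold tripleDegree
  refine Fintype.sum_equiv (σ.prodCongr (σ.prodCongr σ)) _ _ fun t => ?_
  rw [tripleInd_comp π y σ.injective]
  simp only [Equiv.prodCongr_apply, Prod.map_fst, Prod.map_snd, σ.injective.eq_iff]
  rfl

theorem tripleDegree_le (π : J → B) (y : I → J) (i : I) :
    tripleDegree π y i ≤ binWeight π Finset.univ y (π (y i)) ^ 3 := by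
  refine le_trans (Finset.sum_le_sum fun t _ => ?_) (sum_tripleInd_bin_le π y (π (y i)))
  by_cases ht : tripleInd π y t = 0
  · simp [ht]
  have h0 := tripleInd_nonneg π y t
  obtain ⟨-, h1, h2⟩ := tripleInd_ne_zero ht
  split_ifs with hm hb
  · exact le_rfl
  · exfalso
    apply hb
    rcases hm with rfl | rfl | rfl
    · exact h1.symm
    · rw [h2]
    · rfl
  · exact h0
  · exact le_rfl

/-- Double counting: one degree is expanded over its triples, so each triple collects the degrees of
its three members. They share a coarse bin, and `tripleDegree_le` bounds each by its cubed
occupancy. -/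
theorem sum_sq_tripleDegree_le (π : J → B) (y : I → J) :
    ∑ i, tripleDegree π y i ^ 2 ≤ 3 * clusterWeight π Finset.univ y := by
  have h1 : ∀ i, tripleDegree π y i ^ 2 = ∑ t : I × I × I,
      tripleInd π y t *
        (if t.1 = i ∨ t.2.1 = i ∨ t.2.2 = i then tripleDegree π y i else 0) := by
    intro i
    rw [sq]
    conv_lhs => enter [1]; rw [tripleDegree]
    rw [Finset.sum_mul]
    refine Finset.sum_congr rfl fun t _ => ?_
    split_ifs <;> ring
  have h2 : ∀ t : I × I × I, ∑ i, tripleInd π y t *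
      (if t.1 = i ∨ t.2.1 = i ∨ t.2.2 = i then tripleDegree π y i else 0) ≤
      3 * (tripleInd π y t * binWeight π Finset.univ y (π (y t.2.2)) ^ 3) := by
    intro t
    rw [← Finset.mul_sum]
    by_cases ht : tripleInd π y t = 0
    · simp [ht]
    obtain ⟨-, g1, g2⟩ := tripleInd_ne_zero ht
    rw [tripleInd_eq_one ht, one_mul, one_mul]
    have h3 : ∑ i, (if t.1 = i ∨ t.2.1 = i ∨ t.2.2 = i then tripleDegree π y i else 0) ≤
        ∑ i, ((if t.1 = i then tripleDegree π y i else 0)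
          + (if t.2.1 = i then tripleDegree π y i else 0)
          + (if t.2.2 = i then tripleDegree π y i else 0)) := by
      refine Finset.sum_le_sum fun i _ => ?_
      have := tripleDegree_nonneg π y i
      by_cases a1 : t.1 = i <;> by_cases a2 : t.2.1 = i <;> by_cases a3 : t.2.2 = i <;>
        simp only [a1, a2, a3, or_self, or_true, if_true, if_false, or_false] <;>
        linarith
    refine h3.trans ?_
    simp only [Finset.sum_add_distrib, Finset.sum_ite_eq, Finset.mem_univ, if_true]
    have d1 := tripleDegree_le π y t.1
    have d2 := tripleDegree_le π y t.2.1
    have d3 := tripleDegree_le π y t.2.2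
    rw [g1] at d1
    rw [g2] at d2
    linarith
  simp_rw [h1]
  rw [Finset.sum_comm]
  refine (Finset.sum_le_sum fun t _ => h2 t).trans ?_
  rw [← Finset.mul_sum]
  unfold clusterWeight
  simp only [Finset.univ_product_univ]
  linarith

/-- Triples avoiding `i` cancel, leaving a difference of two nonnegative degrees. Bounding these by
degrees in the full sample `y` makes the bound the same for all hybrids. -/
theorem sq_tripleCount_sub_le {I' : Type*} [DecidableEq I'] [Fintype I'] (π : J → B)
    (y : I' → J) {s s' : I → I'} (hs : Function.Injective s) (hs' : Function.Injective s') (i : I)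
    (h : ∀ j ≠ i, s j = s' j) :
    (tripleCount π (y ∘ s) - tripleCount π (y ∘ s')) ^ 2 ≤
      tripleDegree π y (s i) ^ 2 + tripleDegree π y (s' i) ^ 2 := by
  have hdeg : ∀ r : I → I', Function.Injective r →
      tripleDegree π (y ∘ r) i ≤ tripleDegree π y (r i) := by
    intro r hr
    unfold tripleDegree
    have hinj : Function.Injective (fun t : I × I × I => (r t.1, r t.2.1, r t.2.2)) := by
      rintro ⟨a, b, c⟩ ⟨a', b', c'⟩ hh
      simp only [Prod.mk.injEq] at hh
      rw [hr hh.1, hr hh.2.1, hr hh.2.2]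
    set f : I' × I' × I' → ℝ := fun t =>
      if t.1 = r i ∨ t.2.1 = r i ∨ t.2.2 = r i then tripleInd π y t else 0 with hf
    have e : ∀ t : I × I × I, (if t.1 = i ∨ t.2.1 = i ∨ t.2.2 = i then
        tripleInd π (y ∘ r) t else 0) = f (r t.1, r t.2.1, r t.2.2) := by
      intro t
      rw [tripleInd_comp π y hr]
      simp [hf, hr.eq_iff]
    simp_rw [e]
    rw [← Finset.sum_image (f := f) fun a _ b _ hab => hinj hab]
    refine Finset.sum_le_sum_of_subset_of_nonneg (Finset.subset_univ _) fun t _ _ => ?_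
    simp only [hf]
    split_ifs
    · exact tripleInd_nonneg _ _ _
    · exact le_rfl
  have hsub : tripleCount π (y ∘ s) - tripleCount π (y ∘ s') =
      tripleDegree π (y ∘ s) i - tripleDegree π (y ∘ s') i := by
    unfold tripleCount tripleDegree
    rw [← Finset.sum_sub_distrib, ← Finset.sum_sub_distrib]
    refine Finset.sum_congr rfl fun t _ => ?_
    split_ifs with hm
    · rfl
    · push Not at hm
      rw [tripleInd_comp π y hs, tripleInd_comp π y hs', h _ hm.1, h _ hm.2.1, h _ hm.2.2]
      simp
  rw [hsub]
  have a1 := hdeg s hs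
  have a2 := hdeg s' hs'
  have b1 := tripleDegree_nonneg π (y ∘ s) i
  have b2 := tripleDegree_nonneg π (y ∘ s') i
  have c1 := pow_le_pow_left₀ b1 a1 2
  have c2 := pow_le_pow_left₀ b2 a2 2
  nlinarith [mul_nonneg b1 b2]

end TripleCount

/-- Central moments of the number of clustered triples in an i.i.d. sample. -/
theorem exists_prodExp_tripleCount_central_moment_le (D : ℝ) (m : ℕ) : ∃ C : ℝ, 0 ≤ C ∧
    ∀ (ι J B : Type) [Fintype ι] [Fintype J] [DecidableEq ι] [DecidableEq J] [DecidableEq B]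
      (p : J → ℝ) (π : J → B) (P Q : ℝ), BinLaw p π P Q → Fintype.card ι * Q ≤ D →
      prodExp p (fun x : ι → J =>
        (tripleCount π x - prodExp p (tripleCount (I := ι) π)) ^ (2 * m + 2)) ≤
        C * (1 + (Fintype.card ι : ℝ) ^ 3 * (P * Q)) ^ (m + 1) := by
  -- Degrees are measured in the doubled sample, hence `2 * D` here and the factor `8 = 2 ^ 3` in
  -- the constant. The occupancy exponent is 0, so any bin serves below.
  obtain ⟨C, hC, hmom⟩ := exists_prodExp_binWeight_clusterWeight_le (2 * D) (m + 1) 0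
  refine ⟨2 * (2 * (2 * m + 1) * 3) ^ (m + 1) * C * 8 ^ (m + 1), by positivity, ?_⟩
  intro ι J B _ _ _ _ _ p π P Q h hD
  have hP := h.fine_nonneg
  have hQ := h.coarse_nonneg'
  obtain ⟨b⟩ : Nonempty B := by
    by_contra hc
    rw [not_nonempty_iff] at hc
    have : IsEmpty J := Function.isEmpty π
    simpa using h.sum_eq_one
  have hcard : (Fintype.card (ι ⊕ ι) : ℝ) = 2 * Fintype.card ι := by
    rw [Fintype.card_sum]; push_cast; ring
  have hm := hmom (ι ⊕ ι) J B p π P Q h (by rw [hcard]; linarith) b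
  simp only [pow_zero, one_mul] at hm
  set Z : (ι → J) → ℝ := fun x => tripleCount π x - prodExp p (tripleCount (I := ι) π) with hZ
  set e : ι → (ι ⊕ ι → J) → ℝ := fun i y =>
    tripleDegree π y (Sum.inl i) ^ 2 + tripleDegree π y (Sum.inr i) ^ 2 with he
  have hZ0 : prodExp p Z = 0 := by
    simp only [hZ]
    rw [prodExp_sub, prodExp_const h.sum_eq_one]
    exact sub_self _
  have hes := prodExp_pow_le_of_efronStein h.nonneg h.sum_eq_one Z hZ0 e
    (fun i y => by
      simp only [he, tripleDegree_comp_perm, Equiv.swap_apply_left, Equiv.swap_apply_right]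
      ring)
    (fun i A y hi => by
      have := sq_tripleCount_sub_le π y (mixSection_injective A)
        (mixSection_injective (insert i A)) i
        (fun j hj => by simp [mixSection, hj])
      simp only [hZ, he, sub_sub_sub_cancel_right]
      simpa [mixSection, hi] using this) m
  refine hes.trans ?_
  have hsum : ∀ y, ∑ i, e i y ≤ 3 * clusterWeight π Finset.univ y := fun y => by
    refine le_trans (le_of_eq ?_) (sum_sq_tripleDegree_le π y)
    rw [Fintype.sum_sum_type, ← Finset.sum_add_distrib]
  have hsum0 : ∀ y, 0 ≤ ∑ i, e i y := fun y => Finset.sum_nonneg fun i _ => by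
    simp only [he]; positivity
  have hbd : prodExp p (fun y => (2 * (2 * m + 1) * ∑ i, e i y) ^ (m + 1)) ≤
      prodExp p (fun y => (2 * (2 * m + 1) * 3) ^ (m + 1) *
        clusterWeight π (Finset.univ : Finset (ι ⊕ ι)) y ^ (m + 1)) := by
    refine prodExp_mono h.nonneg fun y => ?_
    rw [← mul_pow]
    have := hsum0 y
    refine pow_le_pow_left₀ (by positivity) ?_ _
    rw [mul_assoc _ (3 : ℝ)]
    exact mul_le_mul_of_nonneg_left (hsum y) (by positivity)
  rw [prodExp_const_mul] at hbd
  have hlam : (1 + (Fintype.card (ι ⊕ ι) : ℝ) ^ 3 * (P * Q)) ≤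
      8 * (1 + (Fintype.card ι : ℝ) ^ 3 * (P * Q)) := by
    rw [hcard, mul_pow]
    nlinarith
  calc _ ≤ 2 * ((2 * (2 * m + 1) * 3) ^ (m + 1) *
        (C * (1 + (Fintype.card (ι ⊕ ι) : ℝ) ^ 3 * (P * Q)) ^ (m + 1))) := by
        refine mul_le_mul_of_nonneg_left (hbd.trans ?_) zero_le_two
        exact mul_le_mul_of_nonneg_left hm (by positivity)
    _ ≤ 2 * ((2 * (2 * m + 1) * 3) ^ (m + 1) *
        (C * (8 * (1 + (Fintype.card ι : ℝ) ^ 3 * (P * Q))) ^ (m + 1))) := by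
        gcongr
    _ = _ := by rw [mul_pow 8]; ring

/-! ### Haar bins and the integrated product of kernels. -/

section HaarKernel

/-- The index of the dyadic interval `(j/k, (j+1)/k]` that contains `x`. -/
def haarBin (k : ℕ) (x : ℝ) : ℕ := ⌈x * k⌉₊ - 1

theorem measurable_haarBin (k : ℕ) : Measurable (haarBin k) :=
  (measurable_of_countable fun m : ℕ => m - 1).comp
    (Nat.measurable_ceil.comp (measurable_id.mul_const _))

/-- For `x > 0` the ceiling is at least 1 when `k > 0`, so the truncated subtraction in `haarBin` is
exact; nonpositive points fall into bin 0 by default. -/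
theorem haarBin_eq_iff {k : ℕ} (hk : 0 < k) {x : ℝ} (hx : 0 < x) (j : ℕ) :
    haarBin k x = j ↔ x ∈ Set.Ioc ((j : ℝ) / k) (((j : ℝ) + 1) / k) := by
  have hk' : (0 : ℝ) < k := by exact_mod_cast hk
  have hpos : 0 < ⌈x * k⌉₊ := Nat.ceil_pos.2 (by positivity)
  rw [Set.mem_Ioc, div_lt_iff₀ hk', le_div_iff₀ hk', haarBin]
  have h1 : (j : ℝ) < x * k ↔ j < ⌈x * k⌉₊ := Nat.lt_ceil.symm
  have h2 : x * k ≤ (j : ℝ) + 1 ↔ ⌈x * k⌉₊ ≤ j + 1 := by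
    rw [Nat.ceil_le]; push_cast; rfl
  rw [h1, h2]
  omega

theorem haarBin_lt {k : ℕ} (hk : 0 < k) {x : ℝ} (hx : x ∈ Set.Ioc (0 : ℝ) 1) :
    haarBin k x < k := by
  have hk' : (0 : ℝ) < k := by exact_mod_cast hk
  have : ⌈x * k⌉₊ ≤ k := by
    rw [Nat.ceil_le]
    nlinarith [hx.2]
  unfold haarBin
  omega

/-- Haar intervals are nested. -/
theorem haarBin_mul_div {k r : ℕ} (hk : 0 < k) (hr : 0 < r) {x : ℝ} (hx : 0 < x) :
    haarBin (k * r) x / r = haarBin k x := by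
  symm
  have hk' : (0 : ℝ) < k := by exact_mod_cast hk
  have hr' : (0 : ℝ) < r := by exact_mod_cast hr
  set j := haarBin (k * r) x with hj
  have h := (haarBin_eq_iff (Nat.mul_pos hk hr) hx j).1 hj.symm
  rw [haarBin_eq_iff hk hx]
  have d1 : j / r * r ≤ j := Nat.div_mul_le_self j r
  have d2 : j + 1 ≤ (j / r + 1) * r := Nat.lt_mul_of_div_lt (Nat.lt_succ_self _) hr
  have d1' : ((j / r : ℕ) : ℝ) * r ≤ j := by exact_mod_cast d1
  have d2' : (j : ℝ) + 1 ≤ (((j / r : ℕ) : ℝ) + 1) * r := by exact_mod_cast d2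
  have e : ∀ z : ℝ, z / k = z * r / ((k * r : ℕ) : ℝ) := fun z => by
    push_cast; field_simp
  have hkr : (0 : ℝ) < ((k * r : ℕ) : ℝ) := by push_cast; positivity
  rw [e, e]
  exact ⟨(div_le_div_of_nonneg_right d1' hkr.le).trans_lt h.1,
    h.2.trans (div_le_div_of_nonneg_right d2' hkr.le)⟩

theorem haarBin_eq_of_dvd {k l : ℕ} (hl : 0 < l) (h : k ∣ l) {x y : ℝ} (hx : 0 < x)
    (hy : 0 < y) (hxy : haarBin l x = haarBin l y) : haarBin k x = haarBin k y := by
  obtain ⟨r, rfl⟩ := h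
  have hk := Nat.pos_of_mul_pos_right hl
  have hr := Nat.pos_of_mul_pos_left hl
  rw [← haarBin_mul_div hk hr hx, ← haarBin_mul_div hk hr hy, hxy]

theorem haarKernel_eq {k : ℕ} (hk : 0 < k) {t u : ℝ} (ht : t ∈ Set.Ioc (0 : ℝ) 1)
    (hu : u ∈ Set.Ioc (0 : ℝ) 1) :
    haarKernel k t u = if haarBin k t = haarBin k u then (k : ℝ) else 0 := by
  have hs : ∀ (j : ℕ) (x : ℝ), x ∈ Set.Ioc (0 : ℝ) 1 →
      haarScaling k j x = √(k : ℝ) * if haarBin k x = j then 1 else 0 := by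
    intro j x hx
    unfold haarScaling
    rw [Set.indicator_apply]
    simp only [haarBin_eq_iff hk hx.1 j]
  unfold haarKernel
  have hsq : √(k : ℝ) * √(k : ℝ) = k := Real.mul_self_sqrt (Nat.cast_nonneg k)
  calc _ = ∑ j ∈ Finset.range k, if haarBin k u = j then
        (if haarBin k t = haarBin k u then (k : ℝ) else 0) else 0 := by
        refine Finset.sum_congr rfl fun j _ => ?_
        rw [hs j t ht, hs j u hu]
        by_cases h1 : haarBin k u = j
        · subst h1
          simp only [if_true]
          split_ifs <;> simp [hsq]
        · simp [h1]
    _ = _ := by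
        rw [Finset.sum_ite_eq, if_pos (Finset.mem_range.2 (haarBin_lt hk hu))]

theorem measurable_haarScaling (k j : ℕ) : Measurable (haarScaling k j) :=
  measurable_const.mul (measurable_const.indicator measurableSet_Ioc)

theorem measurable_haarKernel_left (k : ℕ) (u : ℝ) : Measurable fun t => haarKernel k t u :=
  Finset.measurable_sum _ fun j _ => (measurable_haarScaling k j).mul_const _

theorem abs_haarScaling_le (k j : ℕ) (x : ℝ) : |haarScaling k j x| ≤ √(k : ℝ) := by
  unfold haarScaling
  rw [Set.indicator_apply]
  split_ifs <;> simp [abs_of_nonneg]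

theorem abs_haarKernel_le (k : ℕ) (t u : ℝ) : |haarKernel k t u| ≤ k * k := by
  unfold haarKernel
  refine (Finset.abs_sum_le_sum_abs _ _).trans ?_
  refine (Finset.sum_le_sum (g := fun _ => (k : ℝ)) fun j _ => ?_).trans (by simp)
  rw [abs_mul]
  calc _ ≤ √(k : ℝ) * √(k : ℝ) := by gcongr <;> exact abs_haarScaling_le _ _ _
    _ = k := Real.mul_self_sqrt (Nat.cast_nonneg k)

/-- The integrated product of three Haar projection kernels. -/
def haarTriple (a b c : ℕ) (u v w : ℝ) : ℝ :=
  ∫ t in (0 : ℝ)..1, haarKernel a t u * haarKernel b t v * haarKernel c t w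

theorem intervalIntegrable_haarKernel_mul (a b c : ℕ) (u v w : ℝ) :
    IntervalIntegrable (fun t => haarKernel a t u * haarKernel b t v * haarKernel c t w)
      volume 0 1 := by
  rw [intervalIntegrable_iff, Set.uIoc_of_le zero_le_one, IntegrableOn]
  refine Integrable.of_bound (C := (a * a) * (b * b) * (c * c))
    (((measurable_haarKernel_left a u).mul (measurable_haarKernel_left b v)).mul
      (measurable_haarKernel_left c w)).aestronglyMeasurable
    (Filter.Eventually.of_forall fun t => ?_)
  rw [Real.norm_eq_abs, abs_mul, abs_mul]
  gcongr <;> exact abs_haarKernel_le _ _ _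

theorem integral_haarKernel {c : ℕ} (hc : 0 < c) {w : ℝ} (hw : w ∈ Set.Ioc (0 : ℝ) 1) :
    ∫ t in (0 : ℝ)..1, haarKernel c t w = 1 := by
  have hc' : (0 : ℝ) < c := by exact_mod_cast hc
  set j := haarBin c w with hj
  have hjc : (j : ℝ) + 1 ≤ c := by exact_mod_cast haarBin_lt hc hw
  have hS : Set.Ioc ((j : ℝ) / c) (((j : ℝ) + 1) / c) ⊆ Set.Ioc (0 : ℝ) 1 :=
    Set.Ioc_subset_Ioc (by positivity) ((div_le_one hc').2 hjc)
  rw [intervalIntegral.integral_of_le zero_le_one]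
  calc ∫ t in Set.Ioc (0 : ℝ) 1, haarKernel c t w
      = ∫ t in Set.Ioc (0 : ℝ) 1,
          (Set.Ioc ((j : ℝ) / c) (((j : ℝ) + 1) / c)).indicator (fun _ => (c : ℝ)) t := by
        refine setIntegral_congr_fun measurableSet_Ioc fun t ht => ?_
        rw [haarKernel_eq hc ht hw, Set.indicator_apply]
        exact if_congr (haarBin_eq_iff hc ht.1 j) rfl rfl
    _ = 1 := by
        rw [setIntegral_indicator measurableSet_Ioc, Set.inter_eq_self_of_subset_right hS,
          setIntegral_const, measureReal_def, Real.volume_Ioc, ← sub_div, add_sub_cancel_left,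
          ENNReal.toReal_ofReal (by positivity), smul_eq_mul]
        field_simp

/-- On the support of `K_c(·, w)` the coarser bins of `t` are those of `w`. The other two kernels
are constant there, and `K_c(·, w)` has integral one. -/
theorem haarTriple_eq {a b c : ℕ} (hc : 0 < c) (hac : a ∣ c) (hbc : b ∣ c) {u v w : ℝ}
    (hu : u ∈ Set.Ioc (0 : ℝ) 1) (hv : v ∈ Set.Ioc (0 : ℝ) 1) (hw : w ∈ Set.Ioc (0 : ℝ) 1) :
    haarTriple a b c u v w =
      (a : ℝ) * b * if haarBin a u = haarBin a w ∧ haarBin b v = haarBin b w then 1 else 0 := by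
  have ha : 0 < a := Nat.pos_of_dvd_of_pos hac hc
  have hb : 0 < b := Nat.pos_of_dvd_of_pos hbc hc
  unfold haarTriple
  set E : ℝ := (a : ℝ) * b *
    if haarBin a u = haarBin a w ∧ haarBin b v = haarBin b w then 1 else 0 with hE
  have h1 : E = ∫ t in (0 : ℝ)..1, E * haarKernel c t w := by
    rw [intervalIntegral.integral_const_mul, integral_haarKernel hc hw, mul_one]
  rw [h1, intervalIntegral.integral_of_le (zero_le_one' ℝ),
    intervalIntegral.integral_of_le (zero_le_one' ℝ)]
  refine setIntegral_congr_fun measurableSet_Ioc fun t ht => ?_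
  simp only [haarKernel_eq ha ht hu, haarKernel_eq hb ht hv, haarKernel_eq hc ht hw, hE]
  by_cases h : haarBin c t = haarBin c w
  · rw [haarBin_eq_of_dvd hc hac ht.1 hw.1 h, haarBin_eq_of_dvd hc hbc ht.1 hw.1 h, ite_and]
    simp only [eq_comm (a := haarBin a w), eq_comm (a := haarBin b w)]
    split_ifs <;> ring
  · simp [h]

end HaarKernel

/-! ### Reduction of the estimator to counts of clustered triples. -/

section UStat

theorem uStatThree_sub (n : ℕ) (g h : ℝ → ℝ → ℝ → ℝ) (x : Fin n → ℝ) :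
    uStatThree n (fun u v w => g u v w - h u v w) x = uStatThree n g x - uStatThree n h x := by
  unfold uStatThree
  rw [← sub_div]
  simp only [← Finset.sum_sub_distrib]
  congr 1
  refine Finset.sum_congr rfl fun i _ => Finset.sum_congr rfl fun j _ =>
    Finset.sum_congr rfl fun k _ => ?_
  split_ifs <;> simp

theorem uStatThree_swap_left (n : ℕ) (h : ℝ → ℝ → ℝ → ℝ) (x : Fin n → ℝ) :
    uStatThree n (fun u v w => h v u w) x = uStatThree n h x := by
  unfold uStatThree
  rw [Finset.sum_comm]
  congr 1
  refine Finset.sum_congr rfl fun i _ => Finset.sum_congr rfl fun j _ =>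
    Finset.sum_congr rfl fun k _ => ?_
  refine if_congr ?_ rfl rfl
  tauto

theorem uStatThree_swap_right (n : ℕ) (h : ℝ → ℝ → ℝ → ℝ) (x : Fin n → ℝ) :
    uStatThree n (fun u v w => h u w v) x = uStatThree n h x := by
  unfold uStatThree
  congr 1
  refine Finset.sum_congr rfl fun i _ => ?_
  rw [Finset.sum_comm]
  refine Finset.sum_congr rfl fun j _ =>
    Finset.sum_congr rfl fun k _ => ?_
  refine if_congr ?_ rfl rfl
  tauto

theorem haarTriple_swap_left (a b c : ℕ) :
    haarTriple b a c = fun u v w => haarTriple a b c v u w := by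
  funext u v w
  simp only [haarTriple, mul_comm (haarKernel b _ u)]

theorem haarTriple_swap_right (a b c : ℕ) :
    haarTriple a c b = fun u v w => haarTriple a b c u w v := by
  funext u v w
  simp only [haarTriple, mul_right_comm (haarKernel a _ u)]

theorem uStatThree_haarTriple_swap_left (n a b c : ℕ) (x : Fin n → ℝ) :
    uStatThree n (haarTriple b a c) x = uStatThree n (haarTriple a b c) x := by
  rw [haarTriple_swap_left a b c, uStatThree_swap_left]

theorem uStatThree_haarTriple_swap_right (n a b c : ℕ) (x : Fin n → ℝ) :
    uStatThree n (haarTriple a c b) x = uStatThree n (haarTriple a b c) x := by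
  rw [haarTriple_swap_right a b c, uStatThree_swap_right]

theorem integral_haarKernelDiff_mid (a b c d : ℕ) (u v w : ℝ) :
    ∫ t in (0 : ℝ)..1, haarKernel a t u * haarKernelDiff b c t v * haarKernel d t w =
      haarTriple a c d u v w - haarTriple a b d u v w := by
  unfold haarTriple
  rw [← intervalIntegral.integral_sub (intervalIntegrable_haarKernel_mul _ _ _ _ _ _)
    (intervalIntegrable_haarKernel_mul _ _ _ _ _ _)]
  congr 1
  funext t
  simp only [haarKernelDiff]
  ring

theorem integral_haarKernelDiff_mid_right (a b c d e : ℕ) (u v w : ℝ) :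
    ∫ t in (0 : ℝ)..1, haarKernel a t u * haarKernelDiff b c t v * haarKernelDiff d e t w =
      (haarTriple a c e u v w - haarTriple a b e u v w)
        - (haarTriple a c d u v w - haarTriple a b d u v w) := by
  have hi := fun d => ((intervalIntegrable_haarKernel_mul a c d u v w).sub
    (intervalIntegrable_haarKernel_mul a b d u v w))
  rw [← integral_haarKernelDiff_mid, ← integral_haarKernelDiff_mid]
  rw [← intervalIntegral.integral_sub]
  · congr 1
    funext t
    simp only [haarKernelDiff]
    ring
  · refine (hi e).congr fun t _ => ?_
    simp only [haarKernelDiff]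
    ring
  · refine (hi d).congr fun t _ => ?_
    simp only [haarKernelDiff]
    ring

theorem integral_haarKernelDiff_all (a b c d e f : ℕ) (u v w : ℝ) :
    ∫ t in (0 : ℝ)..1,
        haarKernelDiff a b t u * haarKernelDiff c d t v * haarKernelDiff e f t w =
      ((haarTriple b d f u v w - haarTriple b c f u v w)
        - (haarTriple b d e u v w - haarTriple b c e u v w))
      - ((haarTriple a d f u v w - haarTriple a c f u v w)
        - (haarTriple a d e u v w - haarTriple a c e u v w)) := by
  have hi := fun g => ((intervalIntegrable_haarKernel_mul g d f u v w).sub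
    (intervalIntegrable_haarKernel_mul g c f u v w)).sub
    ((intervalIntegrable_haarKernel_mul g d e u v w).sub
    (intervalIntegrable_haarKernel_mul g c e u v w))
  rw [← integral_haarKernelDiff_mid_right, ← integral_haarKernelDiff_mid_right]
  rw [← intervalIntegral.integral_sub]
  · congr 1
    funext t
    simp only [haarKernelDiff]
    ring
  · refine (hi b).congr fun t _ => ?_
    simp only [haarKernelDiff]
    ring
  · refine (hi a).congr fun t _ => ?_
    simp only [haarKernelDiff]
    ring

/-- Averaging over all ordered triples makes the U-statistic symmetric in its three levels; after
sorting them, every term with two or more levels `k₁` cancels. -/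
theorem cubicEstimator_eq_haarTriple (k₁ k₂ k₃ n : ℕ) (x : Fin n → ℝ) :
    cubicEstimator k₁ k₂ k₃ n x =
      3 * uStatThree n (haarTriple k₁ k₃ k₃) x + 3 * uStatThree n (haarTriple k₂ k₂ k₃) x
      - 2 * uStatThree n (haarTriple k₂ k₂ k₂) x - 6 * uStatThree n (haarTriple k₁ k₂ k₃) x
      + 3 * uStatThree n (haarTriple k₁ k₂ k₂) x := by
  unfold cubicEstimator
  simp only [integral_haarKernelDiff_mid, integral_haarKernelDiff_mid_right,
    integral_haarKernelDiff_all, uStatThree_sub]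
  have e1 : uStatThree n (fun u v w => ∫ t in (0 : ℝ)..1,
      haarKernel k₁ t u * haarKernel k₁ t v * haarKernel k₁ t w) x =
      uStatThree n (haarTriple k₁ k₁ k₁) x := rfl
  rw [e1]
  change uStatThree n (haarTriple k₁ k₁ k₁) x
    + 3 * (uStatThree n (haarTriple k₁ k₃ k₁) x - uStatThree n (haarTriple k₁ k₁ k₁) x)
    + 3 * (uStatThree n (haarTriple k₁ k₃ k₃) x - uStatThree n (haarTriple k₁ k₁ k₃) x
      - (uStatThree n (haarTriple k₁ k₃ k₁) x - uStatThree n (haarTriple k₁ k₁ k₁) x))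
    + 3 * (uStatThree n (haarTriple k₂ k₂ k₃) x - uStatThree n (haarTriple k₂ k₁ k₃) x
      - (uStatThree n (haarTriple k₂ k₂ k₂) x - uStatThree n (haarTriple k₂ k₁ k₂) x)
      - (uStatThree n (haarTriple k₁ k₂ k₃) x - uStatThree n (haarTriple k₁ k₁ k₃) x
      - (uStatThree n (haarTriple k₁ k₂ k₂) x - uStatThree n (haarTriple k₁ k₁ k₂) x)))
    + (uStatThree n (haarTriple k₂ k₂ k₂) x - uStatThree n (haarTriple k₂ k₁ k₂) x
      - (uStatThree n (haarTriple k₂ k₂ k₁) x - uStatThree n (haarTriple k₂ k₁ k₁) x)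
      - (uStatThree n (haarTriple k₁ k₂ k₂) x - uStatThree n (haarTriple k₁ k₁ k₂) x
      - (uStatThree n (haarTriple k₁ k₂ k₁) x - uStatThree n (haarTriple k₁ k₁ k₁) x))) = _
  rw [uStatThree_haarTriple_swap_right n k₁ k₁ k₃, uStatThree_haarTriple_swap_left n k₁ k₂ k₃,
    uStatThree_haarTriple_swap_right n k₂ k₁ k₂, uStatThree_haarTriple_swap_left n k₁ k₂ k₂,
    uStatThree_haarTriple_swap_left n k₁ k₂ k₁, uStatThree_haarTriple_swap_right n k₁ k₁ k₂]
  ring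

/-- Evaluated at a sample in `(0, 1]`, the U-statistic with kernel `haarTriple a b c` counts
triples that are clustered in the Haar bins of levels `a` and `b`. -/
theorem uStatThree_haarTriple_eq {J : Type*} [DecidableEq J] {n a b c : ℕ} (hc : 0 < c)
    (hac : a ∣ c) (hbc : b ∣ c) (π : J → ℕ) (β : ℝ → J) (x : Fin n → ℝ)
    (hx : ∀ i, x i ∈ Set.Ioc (0 : ℝ) 1)
    (hπ : ∀ i, π (β (x i)) = haarBin a (x i))
    (hβ : ∀ i j, β (x i) = β (x j) ↔ haarBin b (x i) = haarBin b (x j)) :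
    uStatThree n (haarTriple a b c) x =
      (a : ℝ) * b / ((n : ℝ) * ((n : ℝ) - 1) * ((n : ℝ) - 2)) * tripleCount π (β ∘ x) := by
  unfold uStatThree tripleCount
  rw [div_mul_eq_mul_div, Finset.mul_sum, Fintype.sum_prod_type]
  simp_rw [Fintype.sum_prod_type]
  congr 1
  refine Finset.sum_congr rfl fun i _ => Finset.sum_congr rfl fun j _ =>
    Finset.sum_congr rfl fun k _ => ?_
  rw [haarTriple_eq hc hac hbc (hx i) (hx j) (hx k)]
  simp only [tripleInd, Function.comp_apply, hπ, hβ]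
  split_ifs <;> simp_all

end UStat

/-! ### Calculus of central moments of bounded variables. -/

section CentralMoment

set_option linter.unusedSectionVars false

variable {Ω : Type*} [MeasurableSpace Ω] {μ : Measure Ω} [IsProbabilityMeasure μ]

/-- `V` is almost surely bounded and its central moment of order `2 * m` is at most `K`. -/
structure CentralMomentLe (μ : Measure Ω) (m : ℕ) (K : ℝ) (V : Ω → ℝ) : Prop where
  aestronglyMeasurable : AEStronglyMeasurable V μ
  bounded : ∃ R, ∀ᵐ ω ∂μ, |V ω| ≤ R
  moment_le : ∫ ω, (V ω - ∫ ω', V ω' ∂μ) ^ (2 * m) ∂μ ≤ K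

theorem CentralMomentLe.integrable {m : ℕ} {K : ℝ} {V : Ω → ℝ} (h : CentralMomentLe μ m K V) :
    Integrable V μ :=
  let ⟨R, hR⟩ := h.bounded
  Integrable.of_bound h.aestronglyMeasurable R hR

theorem integrable_sub_pow {V : Ω → ℝ} (hm : AEStronglyMeasurable V μ)
    (hb : ∃ R, ∀ᵐ ω ∂μ, |V ω| ≤ R) (c : ℝ) (k : ℕ) :
    Integrable (fun ω => (V ω - c) ^ k) μ := by
  obtain ⟨R, hR⟩ := hb
  refine Integrable.of_bound ((hm.sub aestronglyMeasurable_const).pow k) ((R + |c|) ^ k) ?_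
  filter_upwards [hR] with ω hω
  rw [Real.norm_eq_abs, abs_pow]
  exact pow_le_pow_left₀ (abs_nonneg _) ((abs_sub _ _).trans (by linarith)) k

theorem CentralMomentLe.congr {m : ℕ} {K : ℝ} {V W : Ω → ℝ} (h : CentralMomentLe μ m K V)
    (hVW : V =ᵐ[μ] W) : CentralMomentLe μ m K W := by
  obtain ⟨R, hR⟩ := h.bounded
  refine ⟨h.aestronglyMeasurable.congr hVW, ⟨R, ?_⟩, ?_⟩
  · filter_upwards [hR, hVW] with ω h1 h2
    rwa [← h2]
  · rw [← integral_congr_ae hVW]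
    refine le_trans (le_of_eq (integral_congr_ae ?_)) h.moment_le
    filter_upwards [hVW] with ω h2
    rw [h2]

theorem CentralMomentLe.const_mul {m : ℕ} {K : ℝ} {V : Ω → ℝ} (h : CentralMomentLe μ m K V)
    (c : ℝ) : CentralMomentLe μ m (c ^ (2 * m) * K) (fun ω => c * V ω) := by
  obtain ⟨R, hR⟩ := h.bounded
  refine ⟨h.aestronglyMeasurable.const_mul c, ⟨|c| * R, ?_⟩, ?_⟩
  · filter_upwards [hR] with ω h1
    rw [abs_mul]
    gcongr
  · rw [integral_const_mul]
    simp_rw [← mul_sub, mul_pow]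
    rw [integral_const_mul]
    refine mul_le_mul_of_nonneg_left h.moment_le ?_
    rw [pow_mul]; positivity

theorem CentralMomentLe.add {m : ℕ} {K L : ℝ} {V W : Ω → ℝ} (h : CentralMomentLe μ m K V)
    (h' : CentralMomentLe μ m L W) :
    CentralMomentLe μ m (2 ^ (2 * m) * (K + L)) (fun ω => V ω + W ω) := by
  obtain ⟨R, hR⟩ := h.bounded
  obtain ⟨R', hR'⟩ := h'.bounded
  have hm := h.aestronglyMeasurable.add h'.aestronglyMeasurable
  have hb : ∀ᵐ ω ∂μ, |V ω + W ω| ≤ R + R' := by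
    filter_upwards [hR, hR'] with ω h1 h2
    exact (abs_add_le _ _).trans (add_le_add h1 h2)
  refine ⟨hm, ⟨_, hb⟩, ?_⟩
  rw [integral_add h.integrable h'.integrable]
  have i1 := integrable_sub_pow h.aestronglyMeasurable h.bounded (∫ ω', V ω' ∂μ) (2 * m)
  have i2 := integrable_sub_pow h'.aestronglyMeasurable h'.bounded (∫ ω', W ω' ∂μ) (2 * m)
  calc _ ≤ ∫ ω, 2 ^ (2 * m) * ((V ω - ∫ ω', V ω' ∂μ) ^ (2 * m)
        + (W ω - ∫ ω', W ω' ∂μ) ^ (2 * m)) ∂μ := by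
        refine integral_mono (integrable_sub_pow hm ⟨_, hb⟩ _ _) ((i1.add i2).const_mul _)
          fun ω => ?_
        have he : Even (2 * m) := even_two_mul m
        have e := he.add_pow_le (a := V ω - ∫ ω', V ω' ∂μ) (b := W ω - ∫ ω', W ω' ∂μ)
        dsimp only [Pi.add_apply]
        rw [add_sub_add_comm]
        refine e.trans ?_
        have := he.pow_nonneg (V ω - ∫ ω', V ω' ∂μ)
        have := he.pow_nonneg (W ω - ∫ ω', W ω' ∂μ)
        gcongr
        · norm_num
        · omega
    _ ≤ _ := by
        rw [integral_const_mul, integral_add i1 i2]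
        have := h.moment_le
        have := h'.moment_le
        gcongr

theorem CentralMomentLe.integrable_abs_rpow {m : ℕ} {K : ℝ} {V : Ω → ℝ}
    (h : CentralMomentLe μ m K V) {q : ℝ} (hq : 0 ≤ q) :
    Integrable (fun ω => |V ω - ∫ ω', V ω' ∂μ| ^ q) μ := by
  obtain ⟨R, hR⟩ := h.bounded
  set c := ∫ ω', V ω' ∂μ
  have hm : AEMeasurable (fun ω => |V ω - c|) μ := by
    have := (h.aestronglyMeasurable.sub (aestronglyMeasurable_const (b := c))).norm.aemeasurable
    simpa [Real.norm_eq_abs] using this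
  refine Integrable.of_bound (hm.pow_const q).aestronglyMeasurable ((R + |c|) ^ q) ?_
  filter_upwards [hR] with ω hω
  rw [Real.norm_eq_abs, abs_of_nonneg (by positivity)]
  exact Real.rpow_le_rpow (abs_nonneg _) ((abs_sub _ _).trans (by linarith)) hq

/-- Lyapunov's inequality for the central moments. -/
theorem CentralMomentLe.integral_abs_rpow_le {m : ℕ} {K : ℝ} {V : Ω → ℝ}
    (h : CentralMomentLe μ m K V) {q : ℝ} (hq : 0 < q) (hqm : q ≤ m) :
    ∫ ω, |V ω - ∫ ω', V ω' ∂μ| ^ (2 * q) ∂μ ≤ K ^ (q / m) := by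
  have hm0 : (0 : ℝ) < m := hq.trans_le hqm
  set c := ∫ ω', V ω' ∂μ with hc
  have hi := h.integrable_abs_rpow (q := 2 * q) (by positivity)
  rw [← hc] at hi
  have hpow : ∀ ω, (|V ω - c| ^ (2 * q)) ^ ((m : ℝ) / q) = (V ω - c) ^ (2 * m) := by
    intro ω
    rw [← Real.rpow_mul (abs_nonneg _), show 2 * q * (m / q) = ((2 * m : ℕ) : ℝ) by
      push_cast; field_simp, Real.rpow_natCast, pow_mul, sq_abs, ← pow_mul]
  have hJ := (convexOn_rpow (p := (m : ℝ) / q) ((one_le_div hq).2 hqm)).map_integral_le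
    (μ := μ) (f := fun ω => |V ω - c| ^ (2 * q))
    (Real.continuous_rpow_const (by positivity)).continuousOn isClosed_Ici
    (Filter.Eventually.of_forall fun ω => Set.mem_Ici.2 (by positivity)) hi
    (by
      have : (fun x : ℝ => x ^ ((m : ℝ) / q)) ∘ (fun ω => |V ω - c| ^ (2 * q)) =
          fun ω => (V ω - c) ^ (2 * m) := funext hpow
      rw [this]
      exact integrable_sub_pow h.aestronglyMeasurable h.bounded c (2 * m))
  simp only [hpow] at hJ
  have h0 : 0 ≤ ∫ ω, |V ω - c| ^ (2 * q) ∂μ := integral_nonneg fun ω => by positivity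
  have h1 := hJ.trans h.moment_le
  calc _ = ((∫ ω, |V ω - c| ^ (2 * q) ∂μ) ^ ((m : ℝ) / q)) ^ (q / m) := by
        rw [← Real.rpow_mul h0, show (m : ℝ) / q * (q / m) = 1 by field_simp, Real.rpow_one]
    _ ≤ _ := Real.rpow_le_rpow (by positivity) h1 (by positivity)

end CentralMoment

/-! ### From the sample to its finitely many bins. -/

section Transfer

set_option linter.unusedSectionVars false

variable {Ω : Type*} [MeasurableSpace Ω] {μ : Measure Ω} [IsProbabilityMeasure μ]

theorem integral_comp_eq_prodExp {ι J : Type*} [Fintype ι] [DecidableEq ι] [Fintype J]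
    [MeasurableSpace J] [MeasurableSingletonClass J] {X : ι → Ω → ℝ}
    (hX : ∀ i, Measurable (X i)) (hind : iIndepFun X μ) {ν : Measure ℝ}
    (hlaw : ∀ i, μ.map (X i) = ν) {β : ℝ → J} (hβ : Measurable β) (G : (ι → J) → ℝ) :
    ∫ ω, G (fun i => β (X i ω)) ∂μ = prodExp (fun j => ν.real (β ⁻¹' {j})) G := by
  have hY : Measurable fun ω => fun i => β (X i ω) :=
    measurable_pi_lambda _ fun i => hβ.comp (hX i)
  have : IsProbabilityMeasure (μ.map fun ω => fun i => β (X i ω)) :=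
    Measure.isProbabilityMeasure_map hY.aemeasurable
  have hG : Measurable G := measurable_of_finite G
  rw [← integral_map (φ := fun ω => fun i => β (X i ω)) hY.aemeasurable
    hG.aestronglyMeasurable]
  rw [integral_fintype (Integrable.of_finite)]
  unfold prodExp
  refine Finset.sum_congr rfl fun y _ => ?_
  rw [smul_eq_mul]
  congr 1
  rw [map_measureReal_apply hY (measurableSet_singleton y)]
  have hset : (fun ω => fun i => β (X i ω)) ⁻¹' {y} =
      ⋂ i ∈ (Finset.univ : Finset ι), X i ⁻¹' (β ⁻¹' {y i}) := by
    ext ω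
    simp [funext_iff]
  rw [hset, measureReal_def, hind.measure_inter_preimage_eq_mul Finset.univ
    (fun i _ => hβ (measurableSet_singleton _)), ENNReal.toReal_prod]
  refine Finset.prod_congr rfl fun i _ => ?_
  dsimp only
  rw [← measureReal_def, ← hlaw i, map_measureReal_apply (hX i) (hβ (measurableSet_singleton _))]

/-- Only `S ∩ (0, 1]` is constrained: the rest is null for the law, so the arbitrary values of
`haarBinFin` outside `(0, 1]` do no harm. -/
theorem unitIntervalLaw_real_le {f : ℝ → ℝ} {F : ℝ}
    (hf : ∀ᵐ x ∂(volume.restrict (Set.Icc (0 : ℝ) 1)), f x ≤ F) (hF : 0 ≤ F)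
    {S : Set ℝ} (hS : MeasurableSet S) {u v : ℝ} (huv : u ≤ v)
    (hSI : S ∩ Set.Ioc 0 1 ⊆ Set.Ioc u v) :
    (unitIntervalLaw f).real S ≤ F * (v - u) := by
  have h1 : unitIntervalLaw f S ≤ ENNReal.ofReal F * ENNReal.ofReal (v - u) := by
    unfold unitIntervalLaw
    rw [withDensity_apply _ hS]
    calc _ ≤ ∫⁻ _ in S, ENNReal.ofReal F ∂(volume.restrict (Set.Icc (0 : ℝ) 1)) := by
          refine lintegral_mono_ae (ae_restrict_of_ae ?_)
          filter_upwards [hf] with x hx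
          exact ENNReal.ofReal_le_ofReal hx
      _ = ENNReal.ofReal F * volume (S ∩ Set.Ioc (0 : ℝ) 1) := by
          rw [setLIntegral_const, Measure.restrict_congr_set Ioc_ae_eq_Icc.symm,
            Measure.restrict_apply hS]
      _ ≤ _ := by
          gcongr
          exact (measure_mono hSI).trans (by rw [Real.volume_Ioc])
  rw [measureReal_def]
  rw [← ENNReal.ofReal_mul hF] at h1
  exact ENNReal.toReal_le_of_le_ofReal (mul_nonneg hF (sub_nonneg.2 huv)) h1

theorem ae_mem_Ioc_of_map_eq {f : ℝ → ℝ} {Y : Ω → ℝ} (hY : Measurable Y)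
    (hlaw : μ.map Y = unitIntervalLaw f) : ∀ᵐ ω ∂μ, Y ω ∈ Set.Ioc (0 : ℝ) 1 := by
  have h : ∀ᵐ y ∂(μ.map Y), y ∈ Set.Ioc (0 : ℝ) 1 := by
    rw [hlaw]
    refine (withDensity_absolutelyContinuous _ _).ae_le ?_
    rw [Measure.restrict_congr_set Ioc_ae_eq_Icc.symm]
    exact ae_restrict_mem measurableSet_Ioc
  exact ae_of_ae_map hY.aemeasurable h

/-- The dyadic bin as an element of `Fin k`. -/
def haarBinFin (k : ℕ) [NeZero k] (x : ℝ) : Fin k := Fin.ofNat k (haarBin k x)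

theorem measurable_haarBinFin (k : ℕ) [NeZero k] : Measurable (haarBinFin k) :=
  (measurable_of_countable fun m : ℕ => Fin.ofNat k m).comp (measurable_haarBin k)

theorem haarBinFin_val {k : ℕ} [NeZero k] {x : ℝ} (hx : x ∈ Set.Ioc (0 : ℝ) 1) :
    (haarBinFin k x : ℕ) = haarBin k x :=
  Nat.mod_eq_of_lt (haarBin_lt (Nat.pos_of_neZero k) hx)

theorem binLaw_unitIntervalLaw {f : ℝ → ℝ} {F : ℝ}
    (hf : ∀ᵐ x ∂(volume.restrict (Set.Icc (0 : ℝ) 1)), f x ≤ F) (hF : 0 ≤ F)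
    [IsProbabilityMeasure (unitIntervalLaw f)] {a r : ℕ} (ha : 0 < a) (hr : 0 < r)
    [NeZero (a * r)] :
    BinLaw (fun j => (unitIntervalLaw f).real (haarBinFin (a * r) ⁻¹' {j}))
      (fun j : Fin (a * r) => (j : ℕ) / r) (F / ((a * r : ℕ) : ℝ)) (F / a) := by
  have hβ := measurable_haarBinFin (a * r)
  have hlen : ∀ (k : ℕ) (j : ℕ), F * (((j : ℝ) + 1) / k - (j : ℝ) / k) = F / k := by
    intro k j
    rw [← sub_div, add_sub_cancel_left, mul_one_div]
  have hsum : ∀ (T : Finset (Fin (a * r))),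
      ∑ j ∈ T, (unitIntervalLaw f).real (haarBinFin (a * r) ⁻¹' {j}) =
      (unitIntervalLaw f).real (haarBinFin (a * r) ⁻¹' T) := by
    intro T
    rw [← measureReal_biUnion_finset]
    · congr 1
      ext x
      simp
    · intro i _ j _ hij
      exact Disjoint.preimage _ (by simpa using hij)
    · exact fun j _ => hβ (measurableSet_singleton j)
  refine ⟨fun j => measureReal_nonneg, ?_, fun j => ?_, fun b => ?_⟩
  · rw [hsum]
    simp
  · refine (unitIntervalLaw_real_le hf hF (hβ (measurableSet_singleton j))
      (u := ((j : ℕ) : ℝ) / ((a * r : ℕ) : ℝ)) (v := (((j : ℕ) : ℝ) + 1) / ((a * r : ℕ) : ℝ))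
      (by gcongr; linarith) ?_).trans (hlen _ _).le
    rintro x ⟨hx, hx1⟩
    rw [← haarBin_eq_iff (Nat.mul_pos ha hr) hx1.1, ← haarBinFin_val hx1]
    exact congrArg Fin.val hx
  · simp_rw [mul_ite, mul_one, mul_zero]
    rw [← Finset.sum_filter, hsum]
    refine (unitIntervalLaw_real_le hf hF (hβ (Set.toFinite _).measurableSet)
      (u := (b : ℝ) / a) (v := ((b : ℝ) + 1) / a)
      (by gcongr; linarith) ?_).trans (hlen _ _).le
    rintro x ⟨hx, hx1⟩
    rw [← haarBin_eq_iff ha hx1.1, ← haarBin_mul_div ha hr hx1.1, ← haarBinFin_val hx1]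
    simpa using hx

end Transfer

/-! ### Moments of the U-statistics and of the estimator. -/

theorem exists_centralMomentLe_uStatThree_haarTriple (F a₀ : ℝ) (hF : 0 ≤ F) (ha₀ : 0 < a₀)
    (m : ℕ) : ∃ C : ℝ, 0 ≤ C ∧
    ∀ n : ℕ, 3 ≤ n → ∀ a b c : ℕ, 0 < c → a ∣ b → b ∣ c → a₀ * n ≤ a →
    ∀ f : ℝ → ℝ, (∀ᵐ x ∂(volume.restrict (Set.Icc (0 : ℝ) 1)), f x ≤ F) →
    ∀ (Ω : Type*) [MeasurableSpace Ω] (μ : Measure Ω) [IsProbabilityMeasure μ]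
      (X : Fin n → Ω → ℝ), (∀ i, Measurable (X i)) → iIndepFun X μ →
      (∀ i, μ.map (X i) = unitIntervalLaw f) →
      CentralMomentLe μ (m + 1)
        (C * (((a : ℝ) * b / n ^ 3) ^ 2 + (a : ℝ) * b / n ^ 3) ^ (m + 1))
        (fun ω => uStatThree n (haarTriple a b c) (fun i => X i ω)) := by
  obtain ⟨C, hC, hmom⟩ := exists_prodExp_tripleCount_central_moment_le (F / a₀) m
  refine ⟨C * (81 * (1 + F ^ 2)) ^ (m + 1), by positivity, ?_⟩
  intro n hn a b c hc hab hbc han f hf Ω _ μ _ X hX hind hlaw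
  have hb : 0 < b := Nat.pos_of_dvd_of_pos hbc hc
  have hac := hab.trans hbc
  obtain ⟨r, rfl⟩ := hab
  have ha : 0 < a := Nat.pos_of_mul_pos_right hb
  have hr : 0 < r := Nat.pos_of_mul_pos_left hb
  have : NeZero (a * r) := ⟨hb.ne'⟩
  have hn' : (3 : ℝ) ≤ n := by exact_mod_cast hn
  have ha' : (0 : ℝ) < a := by exact_mod_cast ha
  have hb' : (0 : ℝ) < ((a * r : ℕ) : ℝ) := by exact_mod_cast hb
  have hprob : IsProbabilityMeasure (unitIntervalLaw f) := by
    rw [← hlaw ⟨0, by omega⟩]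
    exact Measure.isProbabilityMeasure_map (hX _).aemeasurable
  have hlawb := binLaw_unitIntervalLaw hf hF ha hr
  set p : Fin (a * r) → ℝ := fun j => (unitIntervalLaw f).real (haarBinFin (a * r) ⁻¹' {j})
    with hp
  set π : Fin (a * r) → ℕ := fun j => (j : ℕ) / r with hπ
  have htr : ∀ G : (Fin n → Fin (a * r)) → ℝ,
      ∫ ω, G (fun i => haarBinFin (a * r) (X i ω)) ∂μ = prodExp p G :=
    integral_comp_eq_prodExp hX hind hlaw (measurable_haarBinFin _)
  -- Here `Q = F / a` and `a₀ * n ≤ a`, so `n * Q ≤ F / a₀`: the expected occupancy of a coarse bin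
  -- stays bounded.
  have hm := hmom (Fin n) (Fin (a * r)) ℕ p π _ _ hlawb (by
    rw [Fintype.card_fin, ← mul_div_assoc, div_le_div_iff₀ ha' ha₀]
    nlinarith)
  rw [Fintype.card_fin] at hm
  set T : Ω → ℝ := fun ω => tripleCount π (fun i => haarBinFin (a * r) (X i ω)) with hT
  have hTm : AEStronglyMeasurable T μ := by
    have : Measurable T := (measurable_of_finite (tripleCount π)).comp
      (measurable_pi_lambda _ fun i => (measurable_haarBinFin _).comp (hX i))
    exact this.aestronglyMeasurable
  have hTb : ∃ R, ∀ᵐ ω ∂μ, |T ω| ≤ R := by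
    obtain ⟨R, hR⟩ := (Set.finite_range fun y : Fin n → Fin (a * r) => |tripleCount π y|).bddAbove
    exact ⟨R, Filter.Eventually.of_forall fun ω => hR (Set.mem_range_self _)⟩
  have hTc : CentralMomentLe μ (m + 1)
      (C * (1 + (n : ℝ) ^ 3 * (F / ((a * r : ℕ) : ℝ) * (F / a))) ^ (m + 1)) T := by
    refine ⟨hTm, hTb, ?_⟩
    rw [show ∫ ω', T ω' ∂μ = prodExp p (tripleCount π) from htr (tripleCount π)]
    exact (htr fun y => (tripleCount π y - prodExp p (tripleCount π)) ^ (2 * (m + 1))).trans_le hm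
  have hall : ∀ᵐ ω ∂μ, ∀ i, X i ω ∈ Set.Ioc (0 : ℝ) 1 :=
    ae_all_iff.2 fun i => ae_mem_Ioc_of_map_eq (hX i) (hlaw i)
  set N : ℝ := (n : ℝ) * ((n : ℝ) - 1) * ((n : ℝ) - 2) with hN
  set w : ℝ := (a : ℝ) * ((a * r : ℕ) : ℝ) with hw
  have hw0 : 0 < w := by positivity
  have heq : (fun ω => w / N * T ω) =ᵐ[μ]
      fun ω => uStatThree n (haarTriple a (a * r) c) (fun i => X i ω) := by
    filter_upwards [hall] with ω hω
    rw [uStatThree_haarTriple_eq hc hac hbc π (haarBinFin (a * r)) (fun i => X i ω) hω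
      (fun i => by
        simp only [hπ]
        rw [haarBinFin_val (hω i), haarBin_mul_div ha hr (hω i).1])
      (fun i j => by rw [Fin.ext_iff, haarBinFin_val (hω i), haarBinFin_val (hω j)])]
    rfl
  have hfin := (hTc.const_mul (w / N)).congr heq
  refine ⟨hfin.1, hfin.2, hfin.3.trans ?_⟩
  have hn3 : (0 : ℝ) < (n : ℝ) ^ 3 := by positivity
  have hN9 : (n : ℝ) ^ 3 ≤ 9 * N := by
    have h1 : (n : ℝ) ≤ 3 * ((n : ℝ) - 1) := by linarith
    have h2 : (n : ℝ) ≤ 3 * ((n : ℝ) - 2) := by linarith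
    calc (n : ℝ) ^ 3 = n * n * n := by ring
      _ ≤ n * (3 * ((n : ℝ) - 1)) * (3 * ((n : ℝ) - 2)) :=
        mul_le_mul (by gcongr) h2 (by linarith) (mul_nonneg (by linarith) (by linarith))
      _ = 9 * N := by rw [hN]; ring
  have hN0 : 0 < N := by linarith
  set s : ℝ := w / (n : ℝ) ^ 3 with hs
  have hs0 : 0 < s := by positivity
  have hcs : w / N ≤ 9 * s := by
    rw [hs, div_le_iff₀ hN0]
    calc w = w / (n : ℝ) ^ 3 * (n : ℝ) ^ 3 := by field_simp
      _ ≤ w / (n : ℝ) ^ 3 * (9 * N) := by gcongr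
      _ = _ := by ring
  have hlam : (n : ℝ) ^ 3 * (F / ((a * r : ℕ) : ℝ) * (F / a)) = F ^ 2 / s := by
    rw [hs, hw]; field_simp
  rw [hlam, pow_mul]
  calc ((w / N) ^ 2) ^ (m + 1) * (C * (1 + F ^ 2 / s) ^ (m + 1))
      ≤ ((9 * s) ^ 2) ^ (m + 1) * (C * (1 + F ^ 2 / s) ^ (m + 1)) := by gcongr
    _ = C * ((9 * s) ^ 2 * (1 + F ^ 2 / s)) ^ (m + 1) := by rw [mul_pow ((9 * s) ^ 2)]; ring
    _ ≤ C * (81 * (1 + F ^ 2) * (s ^ 2 + s)) ^ (m + 1) := by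
        have : (9 * s) ^ 2 * (1 + F ^ 2 / s) = 81 * (s ^ 2 + F ^ 2 * s) := by
          field_simp; ring
        rw [this]
        refine mul_le_mul_of_nonneg_left (pow_le_pow_left₀ (by positivity) ?_ _) hC
        nlinarith [mul_nonneg (sq_nonneg F) (sq_nonneg s)]
    _ = _ := by rw [mul_pow (81 * (1 + F ^ 2))]; ring

theorem CentralMomentLe.mono {Ω : Type*} [MeasurableSpace Ω] {μ : Measure Ω} {m : ℕ} {K L : ℝ}
    {V : Ω → ℝ} (h : CentralMomentLe μ m K V) (hKL : K ≤ L) : CentralMomentLe μ m L V :=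
  ⟨h.1, h.2, h.3.trans hKL⟩

theorem dvd_of_eq_two_pow_of_le {k l : ℕ} (hk : ∃ I : ℕ, k = 2 ^ I) (hl : ∃ I : ℕ, l = 2 ^ I)
    (h : k ≤ l) : k ∣ l := by
  obtain ⟨I, rfl⟩ := hk
  obtain ⟨J, rfl⟩ := hl
  exact pow_dvd_pow 2 ((Nat.pow_le_pow_iff_right (by norm_num)).1 h)

namespace AdmissibleLevels

variable {a A β : ℝ} {n k₁ k₂ k₃ : ℕ}

theorem div_sq_le (h : AdmissibleLevels a A β n k₁ k₂ k₃) (hβ : 0 < β) (hn : 1 ≤ n) :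
    (k₃ : ℝ) / (n : ℝ) ^ 2 ≤ |A| := by
  have hn' : (1 : ℝ) ≤ n := by exact_mod_cast hn
  rw [div_le_iff₀ (by positivity)]
  have hexp : 2 / (1 + 4 * β) ≤ 2 := by
    rw [div_le_iff₀ (by positivity)]; linarith
  have h1 := Real.rpow_le_rpow_of_exponent_le hn' hexp
  calc (k₃ : ℝ) ≤ A * (n : ℝ) ^ (2 / (1 + 4 * β)) := h.upper₃
    _ ≤ |A| * (n : ℝ) ^ (2 : ℝ) := by gcongr; exact le_abs_self A
    _ = _ := by rw [Real.rpow_two]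

theorem mul_div_cube_le (h : AdmissibleLevels a A β n k₁ k₂ k₃) (hn : 1 ≤ n) :
    (k₁ : ℝ) * k₃ / (n : ℝ) ^ 3 ≤ |A| * ((k₃ : ℝ) / (n : ℝ) ^ 2) := by
  have hn' : (0 : ℝ) < n := by exact_mod_cast hn
  have h1 : (k₁ : ℝ) ≤ |A| * n :=
    h.upper₁.trans (mul_le_mul_of_nonneg_right (le_abs_self A) hn'.le)
  calc (k₁ : ℝ) * k₃ / (n : ℝ) ^ 3 ≤ |A| * n * k₃ / (n : ℝ) ^ 3 := by gcongr
    _ = _ := by field_simp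

/-- Doubling the upper exponent of `k₂` gives `(3 + 4β)/(1 + 4β) = 1 + 2/(1 + 4β)`, exactly the
order of `n * k₃`. -/
theorem sq_div_cube_le (h : AdmissibleLevels a A β n k₁ k₂ k₃) (ha : 0 < a) (hβ : 0 < β)
    (hn : 1 ≤ n) : (k₂ : ℝ) * k₂ / (n : ℝ) ^ 3 ≤ 1 / a * ((k₃ : ℝ) / (n : ℝ) ^ 2) := by
  have hn' : (0 : ℝ) < n := by exact_mod_cast hn
  have h1 : (k₂ : ℝ) * k₂ ≤ n * (n : ℝ) ^ (2 / (1 + 4 * β)) := by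
    calc (k₂ : ℝ) * k₂ ≤ (n : ℝ) ^ ((3 / 2 + 2 * β) / (1 + 4 * β)) *
          (n : ℝ) ^ ((3 / 2 + 2 * β) / (1 + 4 * β)) := by gcongr <;> exact h.upper₂
      _ = (n : ℝ) ^ (1 + 2 / (1 + 4 * β)) := by
          rw [← Real.rpow_add hn']
          congr 1
          field_simp
          ring
      _ = _ := by rw [Real.rpow_add hn', Real.rpow_one]
  have h2 : (n : ℝ) ^ (2 / (1 + 4 * β)) ≤ 1 / a * k₃ := by
    rw [one_div, ← div_eq_inv_mul, le_div_iff₀ ha, mul_comm]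
    exact h.lower₃
  calc (k₂ : ℝ) * k₂ / (n : ℝ) ^ 3 ≤ n * (1 / a * k₃) / (n : ℝ) ^ 3 := by
        refine div_le_div_of_nonneg_right (h1.trans ?_) (by positivity)
        exact mul_le_mul_of_nonneg_left h2 hn'.le
    _ = _ := by field_simp

end AdmissibleLevels

/-- Even central moments of the cubic estimator. -/
theorem exists_centralMomentLe_cubicEstimator (F a A : ℝ) (hF : 0 ≤ F) (ha : 0 < a) (m : ℕ) :
    ∃ C : ℝ, 0 ≤ C ∧
      ∀ β : ℝ, 0 < β → ∀ n : ℕ, 3 ≤ n →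
      ∀ k₁ k₂ k₃ : ℕ, AdmissibleLevels a A β n k₁ k₂ k₃ →
      ∀ f : ℝ → ℝ, (∀ᵐ x ∂(volume.restrict (Set.Icc (0 : ℝ) 1)), f x ≤ F) →
      ∀ (Ω : Type*) [MeasurableSpace Ω] (μ : Measure Ω) [IsProbabilityMeasure μ]
        (X : Fin n → Ω → ℝ), (∀ i, Measurable (X i)) → iIndepFun X μ →
        (∀ i, μ.map (X i) = unitIntervalLaw f) →
        CentralMomentLe μ (m + 1) (C * ((k₃ : ℝ) / (n : ℝ) ^ 2) ^ (m + 1))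
          (fun ω => cubicEstimator k₁ k₂ k₃ n (fun i => X i ω)) := by
  obtain ⟨C, hC, hU⟩ := exists_centralMomentLe_uStatThree_haarTriple F a hF ha m
  set ρ : ℝ := |A| + 1 / a with hρ
  set R : ℝ := ρ ^ 2 * |A| + ρ with hR
  -- `M` is the price of each of the four additions, and `N` covers the coefficients, the largest
  -- being 6 in absolute value. `R` absorbs `s² + s` into a multiple of `k₃/n²`, using that this
  -- ratio is at most `|A|`.
  set M : ℝ := 2 ^ (2 * (m + 1)) with hM
  set N : ℝ := 6 ^ (2 * (m + 1)) with hN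
  refine ⟨(M * (M * (M * (M * (N + N) + N) + N) + N)) * (C * R ^ (m + 1)), by positivity, ?_⟩
  intro β hβ n hn k₁ k₂ k₃ hk f hf Ω _ μ _ X hX hind hlaw
  have hn1 : 1 ≤ n := by omega
  have hn' : (0 : ℝ) < n := by exact_mod_cast hn1
  have pos₃ : 0 < k₃ := by obtain ⟨I, rfl⟩ := hk.dyadic₃; positivity
  have pos₂ : 0 < k₂ := by obtain ⟨I, rfl⟩ := hk.dyadic₂; positivity
  have dvd₁₂ := dvd_of_eq_two_pow_of_le hk.dyadic₁ hk.dyadic₂ hk.le₁₂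
  have dvd₂₃ := dvd_of_eq_two_pow_of_le hk.dyadic₂ hk.dyadic₃ hk.le₂₃
  have c₁₂ : (k₁ : ℝ) ≤ k₂ := by exact_mod_cast hk.le₁₂
  have c₂₃ : (k₂ : ℝ) ≤ k₃ := by exact_mod_cast hk.le₂₃
  set x : ℝ := (k₃ : ℝ) / (n : ℝ) ^ 2 with hx
  have hx0 : 0 ≤ x := by positivity
  have hxA : x ≤ |A| := hk.div_sq_le hβ hn1
  have h1a : 0 ≤ 1 / a := by positivity
  have s₁₃ : (k₁ : ℝ) * k₃ / (n : ℝ) ^ 3 ≤ ρ * x :=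
    (hk.mul_div_cube_le hn1).trans (by rw [hρ]; nlinarith)
  have s₁₂ : (k₁ : ℝ) * k₂ / (n : ℝ) ^ 3 ≤ ρ * x := le_trans (by gcongr) s₁₃
  have s₂₂ : (k₂ : ℝ) * k₂ / (n : ℝ) ^ 3 ≤ ρ * x :=
    (hk.sq_div_cube_le ha hβ hn1).trans (by rw [hρ]; nlinarith [abs_nonneg A])
  have hK : ∀ s : ℝ, 0 ≤ s → s ≤ ρ * x →
      C * (s ^ 2 + s) ^ (m + 1) ≤ (C * R ^ (m + 1)) * x ^ (m + 1) := by
    intro s hs0 hs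
    rw [mul_assoc, ← mul_pow]
    gcongr
    calc s ^ 2 + s ≤ (ρ * x) ^ 2 + ρ * x := by gcongr
      _ = ρ ^ 2 * x * x + ρ * x := by ring
      _ ≤ ρ ^ 2 * |A| * x + ρ * x := by gcongr
      _ = R * x := by rw [hR]; ring
  set K : ℝ := (C * R ^ (m + 1)) * x ^ (m + 1) with hKdef
  have hK0 : 0 ≤ K := by positivity
  have term : ∀ (c : ℝ) (k l j : ℕ), c ^ 2 ≤ 6 ^ 2 → 0 < j → k ∣ l → l ∣ j → k₁ ≤ k →
      (k : ℝ) * l / (n : ℝ) ^ 3 ≤ ρ * x →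
      CentralMomentLe μ (m + 1) (N * K)
        (fun ω => c * uStatThree n (haarTriple k l j) (fun i => X i ω)) := by
    intro c k l j hc hj hkl hlj hk1 hs
    have hk1' : (k₁ : ℝ) ≤ k := by exact_mod_cast hk1
    have h := ((hU n hn k l j hj hkl hlj (hk.lower₁.trans hk1') f hf Ω μ X hX hind hlaw).mono
      (hK _ (by positivity) hs)).const_mul c
    refine h.mono (mul_le_mul_of_nonneg_right ?_ hK0)
    rw [hN, pow_mul, pow_mul]
    gcongr
  have t₁ := term 3 k₁ k₃ k₃ (by norm_num) pos₃ (dvd₁₂.trans dvd₂₃) dvd_rfl le_rfl s₁₃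
  have t₂ := term 3 k₂ k₂ k₃ (by norm_num) pos₃ dvd_rfl dvd₂₃ hk.le₁₂ s₂₂
  have t₃ := term (-2) k₂ k₂ k₂ (by norm_num) pos₂ dvd_rfl dvd_rfl hk.le₁₂ s₂₂
  have t₄ := term (-6) k₁ k₂ k₃ (by norm_num) pos₃ dvd₁₂ dvd₂₃ le_rfl s₁₂
  have t₅ := term 3 k₁ k₂ k₂ (by norm_num) pos₂ dvd₁₂ dvd_rfl le_rfl s₁₂
  have h := (((t₁.add t₂).add t₃).add t₄).add t₅
  have e : (fun ω => cubicEstimator k₁ k₂ k₃ n (fun i => X i ω)) = fun ω =>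
      3 * uStatThree n (haarTriple k₁ k₃ k₃) (fun i => X i ω)
      + 3 * uStatThree n (haarTriple k₂ k₂ k₃) (fun i => X i ω)
      + -2 * uStatThree n (haarTriple k₂ k₂ k₂) (fun i => X i ω)
      + -6 * uStatThree n (haarTriple k₁ k₂ k₃) (fun i => X i ω)
      + 3 * uStatThree n (haarTriple k₁ k₂ k₂) (fun i => X i ω) := by
    funext ω
    rw [cubicEstimator_eq_haarTriple]
    ring
  rw [e]
  refine h.mono (le_of_eq ?_)
  rw [hKdef]
  ring

end

theorem mainTheorem3 (q : ℝ) (hq : 1 ≤ q) (fmin fmax : ℝ) (hfmin : 0 < fmin)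
    (a A : ℝ) (ha : 0 < a) :
    ∃ (C : ℝ) (n₀ : ℕ),
      ∀ β : ℝ, 0 < β → β < 1 / 4 →
      ∀ n : ℕ, n₀ ≤ n →
      ∀ k₁ k₂ k₃ : ℕ, AdmissibleLevels a A β n k₁ k₂ k₃ →
      ∀ f : ℝ → ℝ, Measurable f →
        (∀ᵐ x ∂(volume.restrict (Set.Icc (0 : ℝ) 1)), fmin ≤ f x ∧ f x ≤ fmax) →
      ∀ (Ω : Type*) [MeasurableSpace Ω] (μ : Measure Ω) [IsProbabilityMeasure μ]
        (X : Fin n → Ω → ℝ), (∀ i, Measurable (X i)) → iIndepFun X μ →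
        (∀ i, μ.map (X i) = unitIntervalLaw f) →
        Integrable (fun ω => cubicEstimator k₁ k₂ k₃ n (fun i => X i ω)) μ ∧
        Integrable (fun ω => |cubicEstimator k₁ k₂ k₃ n (fun i => X i ω)
            - ∫ ω', cubicEstimator k₁ k₂ k₃ n (fun i => X i ω') ∂μ| ^ (2 * q)) μ ∧
        ∫ ω, |cubicEstimator k₁ k₂ k₃ n (fun i => X i ω)
            - ∫ ω', cubicEstimator k₁ k₂ k₃ n (fun i => X i ω') ∂μ| ^ (2 * q) ∂μ
          ≤ C * ((k₃ : ℝ) / (n : ℝ) ^ 2) ^ q := by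
  have hq0 : 0 < q := zero_lt_one.trans_le hq
  -- The even order `2⌈q⌉` dominates `2q`; Lyapunov's inequality then raises the bound to the power
  -- `q / ⌈q⌉`, which restores the exponent `q` of the rate.
  obtain ⟨m, hm⟩ : ∃ m : ℕ, ⌈q⌉₊ = m + 1 :=
    Nat.exists_eq_succ_of_ne_zero (Nat.ceil_pos.2 hq0).ne'
  have hqm : q ≤ ((m + 1 : ℕ) : ℝ) := hm ▸ Nat.le_ceil q
  obtain ⟨C, hC, hmom⟩ :=
    exists_centralMomentLe_cubicEstimator |fmax| a A (abs_nonneg _) ha m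
  refine ⟨C ^ (q / ((m + 1 : ℕ) : ℝ)), 3, ?_⟩
  intro β hβ _ n hn k₁ k₂ k₃ hk f _ hf Ω _ μ _ X hX hind hlaw
  have h := hmom β hβ n hn k₁ k₂ k₃ hk f
    (hf.mono fun x hx => hx.2.trans (le_abs_self fmax)) Ω μ X hX hind hlaw
  refine ⟨h.integrable, h.integrable_abs_rpow (by positivity),
    (h.integral_abs_rpow_le hq0 hqm).trans (le_of_eq ?_)⟩
  have hx : (0 : ℝ) ≤ (k₃ : ℝ) / (n : ℝ) ^ 2 := by positivity
  rw [Real.mul_rpow hC (by positivity), ← Real.rpow_natCast _ (m + 1), ← Real.rpow_mul hx,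
    mul_div_cancel₀ q (by positivity)]
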